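/- **Comparison principle for the fractional mean curvature flow.** Let $N\ge 1$ and $s\in(0,1)$, let $c_s=\frac{1-s}{\omega_{N-1}}$, where $\omega_{N-1}$ is the volume of the unit ball of $\mathbb R^{N-1}$. For $E\subseteq\mathbb R^N\times[0,\infty)$ write $E(t)=\{x:(x,t)\in E\}$, and let $T^{\mathrm{ext}}=\inf\{t>0: E(r)=\emptyset \text{ for all } r\ge t\}\in[0,+\infty]$ and $d(x,t)=\mathrm{dist}(x,E(t))$. For $z\in L^\infty(\mathbb R^N\times\mathbb R^N\times(0,T))$ let $\mathrm{div}_s z$ be the distribution on $\mathbb R^N\times(0,T)$ given by $$\langle \mathrm{div}_s z,\varphi\rangle=-\frac{c_s}{2}\int_0^T\!\int_{\mathbb R^N}\!\int_{\mathbb R^N} z(x,y,t)\,\frac{\varphi(x,t)-\varphi(y,t)}{|x-y|^{N+s}}\,dx\,dy\,dt,\qquad \varphi\in C_c^\infty(\mathbb R^N\times(0,T)).$$ Let $E^0\subseteq\mathbb R^N$ be closed with compact boundary. A closed set $E\subseteq\mathbb R^N\times[0,\infty)$ is a *weak superflow* of the fractional mean curvature flow $V=-\kappa_s$ with initial datum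 $E^0$ if: (a) $E(0)\subseteq E^0$, and either $E(t)$ is bounded for all $t\ge0$, or $\mathbb R^N\setminus E(t)$ is bounded for all $t\ge 0$; (b) for every $t\ge0$ and $\delta>0$ there is $\tau>0$ such that $E(r)\subseteq E(t)+B_\delta$ for all $r\in(t,t+\tau)$ (with $\emptyset+B_\delta=\emptyset$); (c) $E(r)\to E(t)$ in the Kuratowski sense as $r\nearrow t$, for every $t>0$; (d) there is $z\in L^\infty(\mathbb R^N\times\mathbb R^N\times(0,T^{\mathrm{ext}}))$ with $\|z\|_{L^\infty}\le1$ such that - (d1) $d\in L^1_{\mathrm{loc}}$ and $\partial_t d\ge \mathrm{div}_s z$ in the sense of distributions in $(\mathbb R^N\times(0,T^{\mathrm{ext}}))\setminus E$; - (d2) $z(x,y,t)\,(d(x,t)-d(y,t))=|d(x,t)-d(y,t)|$ for a.e. $(x,y,t)\in\mathbb R^N\times\mathbb R^N\times(0,T^{\mathrm{ext}})$; - (d3) $\mathrm{div}_s z$ is a signed Radon measure in $(\mathbb R^N\times(0,T^{\mathrm{ext}}))\setminus E$ whose positive part satisfies $(\mathrm{div}_s z)^+\in L^\infty(\{(x,t)\in\mathbb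 R^N\times(0,T^{\mathrm{ext}}): d(x,t)\ge\lambda\})$ for every $\lambda>0$. A relatively open set $A\subseteq\mathbb R^N\times[0,\infty)$ is a *weak subflow* with initial datum $E^0$ if $(\mathbb R^N\times[0,\infty))\setminus A$ is a weak superflow with initial datum $\mathbb R^N\setminus\mathrm{Int}(E^0)$. For sets $A,B\subseteq\mathbb R^N$ let $\mathrm{dist}(A,B)=\inf\{|x-y|:x\in A,\ y\in B\}$, equal to $+\infty$ if $A$ or $B$ is empty. **Theorem.** Let $E^0,F^0\subseteq\mathbb R^N$ be closed sets with compact boundary, let $E$ be a weak superflow with initial datum $E^0$ and $F$ a weak subflow with initial datum $F^0$. If $\Delta:=\mathrm{dist}(E^0,\mathbb R^N\setminus F^0)>0$, then $$\mathrm{dist}(E(t),\mathbb R^N\setminus F(t))\ge\Delta\qquad\text{for all } t\ge0 .$$ -/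

import Mathlib

open MeasureTheory Set Filter Topology
open scoped ContDiff ENNReal

noncomputable section

namespace FractionalFlow

/-- The Euclidean space `ℝ^N`. -/
abbrev Space (N : ℕ) : Type := EuclideanSpace ℝ (Fin N)

/-- The set `ℝ^N × [0, ∞)`, inside `ℝ^N × ℝ`. -/
def spaceTime (N : ℕ) : Set (Space N × ℝ) := {p | 0 ≤ p.2}

/-- The time slice `E(t) = {x : (x, t) ∈ E}`. -/
def slice {N : ℕ} (E : Set (Space N × ℝ)) (t : ℝ) : Set (Space N) := {x | (x, t) ∈ E}

/-- The distance between two sets, in `[0, ∞]`; it is `∞` if one of them is empty. -/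
def setDist {X : Type*} [PseudoEMetricSpace X] (A B : Set X) : ℝ≥0∞ :=
  ⨅ x ∈ A, ⨅ y ∈ B, edist x y

/-- Kuratowski convergence of a sequence of sets. -/
def KuratowskiTendsto {X : Type*} [TopologicalSpace X] (D : ℕ → Set X) (L : Set X) : Prop :=
  (∀ x : ℕ → X, (∀ n, x n ∈ D n) → ∀ a, MapClusterPt a atTop x → a ∈ L) ∧
  (∀ a ∈ L, ∃ x : ℕ → X, (∀ n, x n ∈ D n) ∧ Tendsto x atTop (𝓝 a))

/-- The extinction time `inf {t > 0 : E(s) = ∅ for all s ≥ t}`, equal to `+∞` if there is no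
such `t`. -/
def extinctionTime {N : ℕ} (E : Set (Space N × ℝ)) : EReal :=
  sInf {T : EReal | ∃ t : ℝ, T = (t : EReal) ∧ 0 < t ∧ ∀ s : ℝ, t ≤ s → slice E s = ∅}

/-- The open time interval `(0, T^ext)`. -/
def lifespan {N : ℕ} (E : Set (Space N × ℝ)) : Set ℝ :=
  {t | 0 < t ∧ (t : EReal) < extinctionTime E}

/-- The open region `(ℝ^N × (0, T^ext)) \ E`. -/
def outerRegion {N : ℕ} (E : Set (Space N × ℝ)) : Set (Space N × ℝ) :=
  {p | p.2 ∈ lifespan E} \ E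

/-- The function `d(x, t) = dist(x, E(t))`. It is only used for `t ∈ (0, T^ext)`, where the
slices of a superflow are nonempty. -/
def distFun {N : ℕ} (E : Set (Space N × ℝ)) (p : Space N × ℝ) : ℝ :=
  Metric.infDist p.1 (slice E p.2)

/-- The constant `c_s = (1 - s) / ω_{N-1}`, with `ω_{N-1}` the volume of the unit ball of
`ℝ^{N-1}` (for `N ≥ 1`). -/
def fracConst (N : ℕ) (s : ℝ) : ℝ :=
  (1 - s) / (volume : Measure (Space (N - 1))).real (Metric.ball 0 1)

/-- The set `ℝ^N × ℝ^N × I` on which a time-dependent nonlocal vector field lives. -/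
def fieldDomain (N : ℕ) (I : Set ℝ) : Set (Space N × Space N × ℝ) := {q | q.2.2 ∈ I}

/-- The `s`-fractional spatial divergence, on the time interval `I`, of the nonlocal field `z`,
evaluated at `φ`:
`- (c_s / 2) ∫_I ∫ ∫ z(x, y, t) (φ(x, t) - φ(y, t)) / |x - y|^(N + s) dx dy dt`. -/
def fracDiv {N : ℕ} (s : ℝ) (I : Set ℝ) (z : Space N × Space N × ℝ → ℝ)
    (φ : Space N × ℝ → ℝ) : ℝ :=
  -(fracConst N s / 2) *
    ∫ q in fieldDomain N I,
      z q * ((φ (q.1, q.2.2) - φ (q.2.1, q.2.2)) / ‖q.1 - q.2.1‖ ^ ((N : ℝ) + s))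

/-- `φ ∈ C_c^∞(Ω)` (extended by zero). -/
def IsTestFunction {N : ℕ} (Ω : Set (Space N × ℝ)) (φ : Space N × ℝ → ℝ) : Prop :=
  ContDiff ℝ ∞ φ ∧ HasCompactSupport φ ∧ tsupport φ ⊆ Ω

/-- The inequality `∂_t u ≥ T` in the sense of distributions in `Ω`, for a locally integrable
function `u`. -/
def TimeDerivGE {N : ℕ} (Ω : Set (Space N × ℝ)) (u : Space N × ℝ → ℝ)
    (T : (Space N × ℝ → ℝ) → ℝ) : Prop :=
  LocallyIntegrableOn u Ω ∧
  ∀ φ : Space N × ℝ → ℝ, IsTestFunction Ω φ → (∀ p, 0 ≤ φ p) →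
    T φ ≤ -∫ p in Ω, u p * deriv (fun τ => φ (p.1, τ)) p.2

/-- In `Ω` the distribution `T` is the signed Radon measure with Jordan decomposition
`P - M`. -/
def IsJordanDecompositionOn {N : ℕ} (Ω : Set (Space N × ℝ)) (T : (Space N × ℝ → ℝ) → ℝ)
    (P M : Measure (Space N × ℝ)) : Prop :=
  (∀ K : Set (Space N × ℝ), IsCompact K → K ⊆ Ω → P K < ⊤ ∧ M K < ⊤) ∧
  P ⟂ₘ M ∧
  ∀ φ : Space N × ℝ → ℝ, IsTestFunction Ω φ → T φ = (∫ p, φ p ∂P) - ∫ p, φ p ∂M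

/-- On the set `S` the measure `P` is (integration against) a nonnegative function of class
`L^∞(S)`. -/
def IsBoundedDensityOn {N : ℕ} (S : Set (Space N × ℝ)) (P : Measure (Space N × ℝ)) : Prop :=
  ∃ g : Space N × ℝ → ℝ≥0∞, Measurable g ∧
    P.restrict S = (volume.restrict S).withDensity g ∧
    essSup g (volume.restrict S) < ⊤

/-- `z` is a nonlocal Cahn-Hoffman field for the distance function of `E`, witnessing that `E`
evolves as a supersolution. -/
structure IsCalibratingField {N : ℕ} (s : ℝ) (E : Set (Space N × ℝ))
    (z : Space N × Space N × ℝ → ℝ) : Prop where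
  measurable : AEStronglyMeasurable z (volume.restrict (fieldDomain N (lifespan E)))
  norm_le_one : eLpNorm z ⊤ (volume.restrict (fieldDomain N (lifespan E))) ≤ 1
  supersolution : TimeDerivGE (outerRegion E) (distFun E) (fracDiv s (lifespan E) z)
  cahnHoffman : ∀ᵐ q ∂(volume.restrict (fieldDomain N (lifespan E))),
    z q * (distFun E (q.1, q.2.2) - distFun E (q.2.1, q.2.2)) =
      |distFun E (q.1, q.2.2) - distFun E (q.2.1, q.2.2)|
  posPart_bounded : ∃ P M : Measure (Space N × ℝ),
    IsJordanDecompositionOn (outerRegion E) (fracDiv s (lifespan E) z) P M ∧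
    ∀ l : ℝ, 0 < l → IsBoundedDensityOn {p | p.2 ∈ lifespan E ∧ l ≤ distFun E p} P

/-- `E` is a weak superflow of the `s`-fractional mean curvature flow with initial datum `E0`
(a closed set with compact boundary). -/
structure IsWeakSuperflow {N : ℕ} (s : ℝ) (E : Set (Space N × ℝ)) (E0 : Set (Space N)) :
    Prop where
  subset_spaceTime : E ⊆ spaceTime N
  isClosed : IsClosed E
  initial : slice E 0 ⊆ E0
  bounded_or_cobounded :
    (∀ t : ℝ, 0 ≤ t → Bornology.IsBounded (slice E t)) ∨
    (∀ t : ℝ, 0 ≤ t → Bornology.IsBounded (slice E t)ᶜ)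
  right_semicontinuous : ∀ t : ℝ, 0 ≤ t → ∀ δ : ℝ, 0 < δ → ∃ τ : ℝ, 0 < τ ∧
    ∀ r ∈ Ioo t (t + τ), slice E r ⊆ Metric.thickening δ (slice E t)
  left_continuous : ∀ t : ℝ, 0 < t → ∀ r : ℕ → ℝ, (∀ n, 0 ≤ r n ∧ r n < t) →
    Tendsto r atTop (𝓝 t) → KuratowskiTendsto (fun n => slice E (r n)) (slice E t)
  exists_field : ∃ z : Space N × Space N × ℝ → ℝ, IsCalibratingField s E z

/-- `A`, relatively open in `ℝ^N × [0, ∞)`, is a weak subflow with initial datum `A0` if its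
complement in `ℝ^N × [0, ∞)` is a weak superflow with initial datum the complement of the
interior of `A0`. -/
structure IsWeakSubflow {N : ℕ} (s : ℝ) (A : Set (Space N × ℝ)) (A0 : Set (Space N)) :
    Prop where
  relatively_open : ∃ U : Set (Space N × ℝ), IsOpen U ∧ A = U ∩ spaceTime N
  superflow_compl : IsWeakSuperflow s (spaceTime N \ A) (interior A0)ᶜ

end FractionalFlow

end

open MeasureTheory Set Filter Topology
open scoped ContDiff ENNReal

noncomputable section

namespace FractionalFlow

variable {N : ℕ} {s : ℝ}

/-! ### The fractional divergence on spatially Lipschitz functions -/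

/-! The complement `G` of the subflow is a superflow, so it suffices that two superflows `E`, `G` at
distance at least `D > 0` remain so (`separation_of_superflows`). Separation passes to left limits
in time by Kuratowski convergence; the work is to go from a time `t₀` to the times just after it
(`separation_right_of_bounded`).

Let `d`, `d'` be the distances to the slices of `E`, `G`, with fields `z`, `z'`. Separation at `t₀`
says `d + d' ≥ D` everywhere. Formally, put `φ = (D - d - d')^+`. The time derivative of `∫ φ²` is
at most `-2` times `div_s z + div_s z'` tested against `φ`. This is nonpositive: `z` and `z'` are
the signs of the increments of `d` and `d'`, while `φ` decreases in both. Where these increments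
have opposite signs the fields cancel; where the signs agree both fields pair with the increment of
`φ` with the right sign (`calibration_nonpos`). Hence `φ`, which vanishes at `t₀`, stays zero. Two
points of the slices at distance less than `D` would contradict this at their midpoint, where `d`
and `d'` are both less than `D / 2`.

Two obstacles shape the proof. First, the inequality for `d` holds only away from `E`. So `d` is
replaced by a smoothed maximum of `d` and `c(t) = 4δ + C (t - t₀)`. If `C` bounds the positive part
of `div_s z` on `{d ≥ δ}`, then `c` is also a supersolution for the field `z`, and a convex,
monotone combination of two supersolutions for the same field is again one
(`IsLocalSupersolution.fracDiv_le_softMax`). The truncation confines the defect to a set away from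
both slices, compact because one of the two slices at `t₀` is bounded.

Second, `d` is only left continuous in time and `∂_t d` is only a distribution. The inequality is
therefore integrated to increments between two times, for Lipschitz test functions of space
(`fracDiv_le_of_lipschitz`). The increments of `∫ φ²` are summed over a time grid whose mesh tends
to zero (`integral_sq_defect_le`). The limit needs right continuity at almost every time only, and
left continuity provides it (`ae_tendsto_right`). -/

/-- The singular kernel, tempered by a Lipschitz bound at the diagonal, is integrable. -/
lemma integrable_min_norm_div (hN : 1 ≤ N) (hs0 : 0 < s) (hs1 : s < 1) :
    Integrable (fun w : Space N => min ‖w‖ 1 / ‖w‖ ^ ((N : ℝ) + s)) := by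
  have : Nonempty (Fin N) := ⟨⟨0, hN⟩⟩
  have : Nontrivial (Space N) := inferInstance
  rw [integrable_fun_norm_addHaar volume (f := fun r : ℝ => min r 1 / r ^ ((N : ℝ) + s))]
  rw [← Ioc_union_Ioi_eq_Ioi (zero_le_one (α := ℝ))]
  have hdim : Module.finrank ℝ (Space N) = N := by simp
  have hpow : ∀ y : ℝ, 0 < y → y ^ (N - 1) = y ^ ((N : ℝ) - 1) := by
    intro y hy
    rw [← Real.rpow_natCast, Nat.cast_sub hN, Nat.cast_one]
  refine IntegrableOn.union ?_ ?_
  -- In polar coordinates the integrand is `r ^ (-s)` up to radius one, integrable since `s < 1`,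
  -- and `r ^ (-1 - s)` beyond, integrable since `s > 0`.
  · have h : IntegrableOn (fun y : ℝ => y ^ (-s)) (Ioc 0 1) :=
      (intervalIntegrable_iff_integrableOn_Ioc_of_le zero_le_one).1
        (intervalIntegral.intervalIntegrable_rpow' (by linarith))
    refine h.congr_fun (fun y hy => ?_) measurableSet_Ioc
    simp only [hdim, smul_eq_mul]
    rw [min_eq_left hy.2, hpow y hy.1, eq_comm, mul_div_assoc', div_eq_iff (by have := Real.rpow_pos_of_pos hy.1 ((N:ℝ)+s); positivity), ← Real.rpow_add hy.1]
    nth_rewrite 2 [← Real.rpow_one y]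
    rw [← Real.rpow_add hy.1]
    congr 1; ring
  · have h : IntegrableOn (fun y : ℝ => y ^ (-1 - s)) (Ioi 1) :=
      integrableOn_Ioi_rpow_of_lt (by linarith) one_pos
    refine h.congr_fun (fun y hy => ?_) measurableSet_Ioi
    have hy1 : (1 : ℝ) < y := hy
    have hy0 : (0 : ℝ) < y := by linarith
    simp only [hdim, smul_eq_mul]
    rw [min_eq_right hy1.le, hpow y hy0, eq_comm, mul_one_div, div_eq_iff (by have := Real.rpow_pos_of_pos hy0 ((N:ℝ)+s); positivity), ← Real.rpow_add hy0]
    congr 1; ring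

/-- Bounded functions, Lipschitz in space, supported in a ball times a compact time interval. -/
structure IsSpatiallyLipschitz (L R a b : ℝ) (φ : Space N × ℝ → ℝ) : Prop where
  abs_le : ∀ p, |φ p| ≤ L
  abs_sub_le : ∀ x y t, |φ (x, t) - φ (y, t)| ≤ L * ‖x - y‖
  support : ∀ p, φ p ≠ 0 → ‖p.1‖ ≤ R ∧ p.2 ∈ Icc a b

/-- An integrable majorant for the integrands defining the fractional divergence. -/
def divMajorant (N : ℕ) (s L R a b : ℝ) (q : Space N × Space N × ℝ) : ℝ :=
  (Icc a b).indicator 1 q.2.2 *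
    (((Metric.closedBall (0 : Space N) R).indicator 1 q.1 +
      (Metric.closedBall (0 : Space N) R).indicator 1 q.2.1) *
      (2 * L * (min ‖q.1 - q.2.1‖ 1 / ‖q.1 - q.2.1‖ ^ ((N : ℝ) + s))))

/-- At a fixed time, one variable is confined to a ball and the kernel depends on the difference:
this is a convolution integrand (`h1`) plus its mirror image (`h2`). -/
lemma integrable_divMajorant (hN : 1 ≤ N) (hs0 : 0 < s) (hs1 : s < 1) (L R a b : ℝ) :
    Integrable (divMajorant N s L R a b) := by
  have hk := integrable_min_norm_div hN hs0 hs1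
  have hB : Integrable ((Metric.closedBall (0 : Space N) R).indicator (1 : Space N → ℝ)) :=
    (integrable_indicator_iff Metric.isClosed_closedBall.measurableSet).2
      (integrableOn_const (by exact measure_closedBall_lt_top.ne))
  have hI : Integrable ((Icc a b).indicator (1 : ℝ → ℝ)) :=
    (integrable_indicator_iff measurableSet_Icc).2 (integrableOn_const (by simp))
  have h1 : Integrable (fun p : Space N × Space N =>
      (Metric.closedBall (0 : Space N) R).indicator (1 : Space N → ℝ) p.2 *
      (min ‖p.1 - p.2‖ 1 / ‖p.1 - p.2‖ ^ ((N : ℝ) + s))) (volume.prod volume) :=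
    hB.convolution_integrand (ContinuousLinearMap.mul ℝ ℝ) hk
  have h2 : Integrable (fun p : Space N × Space N =>
      (Metric.closedBall (0 : Space N) R).indicator (1 : Space N → ℝ) p.1 *
      (min ‖p.1 - p.2‖ 1 / ‖p.1 - p.2‖ ^ ((N : ℝ) + s))) (volume.prod volume) := by
    refine h1.swap.congr (Eventually.of_forall fun p => ?_)
    simp [norm_sub_rev p.2 p.1]
  have h3 : Integrable (fun p : Space N × Space N =>
      (((Metric.closedBall (0 : Space N) R).indicator 1 p.1 +
      (Metric.closedBall (0 : Space N) R).indicator 1 p.2) *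
      (2 * L * (min ‖p.1 - p.2‖ 1 / ‖p.1 - p.2‖ ^ ((N : ℝ) + s))))) (volume.prod volume) := by
    refine ((h1.add h2).const_mul (2 * L)).congr (Eventually.of_forall fun p => ?_)
    simp only [Pi.add_apply]; ring
  have h4 := h3.mul_prod hI
  have h5 := (volume_preserving_prodAssoc (α₁ := Space N) (β₁ := Space N) (γ₁ := ℝ)).symm.integrable_comp_emb MeasurableEquiv.prodAssoc.symm.measurableEmbedding |>.2 h4
  refine h5.congr (Eventually.of_forall fun q => ?_)
  simp only [divMajorant, Function.comp]
  rw [mul_comm]; rfl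

/-- The integrand of the fractional divergence. -/
def divIntegrand (s : ℝ) (z : Space N × Space N × ℝ → ℝ) (φ : Space N × ℝ → ℝ)
    (q : Space N × Space N × ℝ) : ℝ :=
  z q * ((φ (q.1, q.2.2) - φ (q.2.1, q.2.2)) / ‖q.1 - q.2.1‖ ^ ((N : ℝ) + s))

/-- The numerator is at most `L ‖x - y‖` near the diagonal and `2 L` far from it, and it vanishes
unless one of the two points lies in the ball and the time in `[a, b]`. -/
lemma IsSpatiallyLipschitz.abs_quotient_le {L R a b : ℝ} {φ : Space N × ℝ → ℝ}
    (h : IsSpatiallyLipschitz L R a b φ) (q : Space N × Space N × ℝ) :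
    |(φ (q.1, q.2.2) - φ (q.2.1, q.2.2)) / ‖q.1 - q.2.1‖ ^ ((N : ℝ) + s)| ≤
      divMajorant N s L R a b q := by
  obtain ⟨x, y, t⟩ := q
  have hL : 0 ≤ L := (abs_nonneg _).trans (h.abs_le (x, t))
  have hk : 0 ≤ ‖x - y‖ ^ ((N : ℝ) + s) := by positivity
  have hnn : 0 ≤ 2 * L * (min ‖x - y‖ 1 / ‖x - y‖ ^ ((N : ℝ) + s)) := by positivity
  have h0 : 0 ≤ divMajorant N s L R a b (x, y, t) := by
    refine mul_nonneg (indicator_nonneg (fun _ _ => zero_le_one) _) (mul_nonneg (add_nonneg ?_ ?_) hnn) <;>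
    exact indicator_nonneg (fun _ _ => zero_le_one) _
  by_cases h1 : φ (x, t) = 0 ∧ φ (y, t) = 0
  · simpa [h1.1, h1.2] using h0
  have key : |(φ (x, t) - φ (y, t)) / ‖x - y‖ ^ ((N : ℝ) + s)| ≤
      2 * L * (min ‖x - y‖ 1 / ‖x - y‖ ^ ((N : ℝ) + s)) := by
    rw [abs_div, abs_of_nonneg hk, ← mul_div_assoc]
    refine div_le_div_of_nonneg_right ?_ hk
    have e1 := h.abs_sub_le x y t
    have e2 : |φ (x, t) - φ (y, t)| ≤ 2 * L := by
      have := abs_sub (φ (x, t)) (φ (y, t))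
      have := h.abs_le (x, t); have := h.abs_le (y, t); linarith
    rcases le_total ‖x - y‖ 1 with hc | hc
    · rw [min_eq_left hc]
      have : 0 ≤ L * ‖x - y‖ := by positivity
      linarith
    · rw [min_eq_right hc]; linarith
  refine key.trans ?_
  have ht : t ∈ Icc a b := by
    by_cases hx : φ (x, t) = 0
    · have hy : φ (y, t) ≠ 0 := fun hy => h1 ⟨hx, hy⟩
      exact (h.support _ hy).2
    · exact (h.support _ hx).2
  have hB : 1 ≤ (Metric.closedBall (0 : Space N) R).indicator (1 : Space N → ℝ) x +
      (Metric.closedBall (0 : Space N) R).indicator 1 y := by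
    by_cases hx : φ (x, t) = 0
    · have hy : φ (y, t) ≠ 0 := fun hy => h1 ⟨hx, hy⟩
      have := (h.support _ hy).1
      rw [indicator_of_mem (a := y) (by simpa using this)]
      have : 0 ≤ (Metric.closedBall (0 : Space N) R).indicator (1 : Space N → ℝ) x :=
        indicator_nonneg (fun _ _ => zero_le_one) _
      simp only [Pi.one_apply]; linarith
    · have := (h.support _ hx).1
      rw [indicator_of_mem (a := x) (by simpa using this)]
      have : 0 ≤ (Metric.closedBall (0 : Space N) R).indicator (1 : Space N → ℝ) y :=
        indicator_nonneg (fun _ _ => zero_le_one) _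
      simp only [Pi.one_apply]; linarith
  simp only [divMajorant, indicator_of_mem ht, Pi.one_apply, one_mul]
  exact le_mul_of_one_le_left hnn hB

/-- Measurable fields on a time interval, bounded by one. -/
structure IsUnitField (I : Set ℝ) (z : Space N × Space N × ℝ → ℝ) : Prop where
  measurable : AEStronglyMeasurable z (volume.restrict (fieldDomain N I))
  abs_le_one : ∀ᵐ q ∂(volume.restrict (fieldDomain N I)), |z q| ≤ 1

lemma measurable_quotient {φ : Space N × ℝ → ℝ} (hφ : Measurable φ) :
    Measurable fun q : Space N × Space N × ℝ =>
      (φ (q.1, q.2.2) - φ (q.2.1, q.2.2)) / ‖q.1 - q.2.1‖ ^ ((N : ℝ) + s) := by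
  refine Measurable.div ?_ ?_
  · exact (hφ.comp (by fun_prop)).sub (hφ.comp (by fun_prop))
  · exact Measurable.pow_const (by fun_prop) _

lemma IsUnitField.aestronglyMeasurable_divIntegrand {I : Set ℝ} {z : Space N × Space N × ℝ → ℝ}
    (hz : IsUnitField I z) {φ : Space N × ℝ → ℝ} (hφ : Measurable φ) :
    AEStronglyMeasurable (divIntegrand s z φ) (volume.restrict (fieldDomain N I)) :=
  hz.measurable.mul (measurable_quotient hφ).aestronglyMeasurable

lemma IsUnitField.abs_divIntegrand_le {I : Set ℝ} {z : Space N × Space N × ℝ → ℝ}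
    (hz : IsUnitField I z) {L R a b : ℝ} {φ : Space N × ℝ → ℝ}
    (h : IsSpatiallyLipschitz L R a b φ) :
    ∀ᵐ q ∂(volume.restrict (fieldDomain N I)), ‖divIntegrand s z φ q‖ ≤ divMajorant N s L R a b q := by
  filter_upwards [hz.abs_le_one] with q hq
  rw [divIntegrand, Real.norm_eq_abs, abs_mul]
  exact (mul_le_of_le_one_left (abs_nonneg _) hq).trans (h.abs_quotient_le q)

lemma IsUnitField.integrable_divIntegrand (hN : 1 ≤ N) (hs0 : 0 < s) (hs1 : s < 1) {I : Set ℝ}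
    {z : Space N × Space N × ℝ → ℝ} (hz : IsUnitField I z) {L R a b : ℝ} {φ : Space N × ℝ → ℝ}
    (hφ : Measurable φ) (h : IsSpatiallyLipschitz L R a b φ) :
    IntegrableOn (divIntegrand s z φ) (fieldDomain N I) :=
  Integrable.mono' (integrable_divMajorant hN hs0 hs1 L R a b).integrableOn
    (hz.aestronglyMeasurable_divIntegrand hφ) (hz.abs_divIntegrand_le h)

lemma fracDiv_eq (I : Set ℝ) (z : Space N × Space N × ℝ → ℝ) (φ : Space N × ℝ → ℝ) :
    fracDiv s I z φ = -(fracConst N s / 2) * ∫ q in fieldDomain N I, divIntegrand s z φ q := rfl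

lemma fracDiv_add (hN : 1 ≤ N) (hs0 : 0 < s) (hs1 : s < 1) {I : Set ℝ}
    {z : Space N × Space N × ℝ → ℝ} (hz : IsUnitField I z) {L R a b L' R' a' b' : ℝ}
    {φ ψ : Space N × ℝ → ℝ} (hφ : Measurable φ) (h : IsSpatiallyLipschitz L R a b φ)
    (hψ : Measurable ψ) (h' : IsSpatiallyLipschitz L' R' a' b' ψ) :
    fracDiv s I z (fun p => φ p + ψ p) = fracDiv s I z φ + fracDiv s I z ψ := by
  rw [fracDiv_eq, fracDiv_eq, fracDiv_eq, ← mul_add,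
    ← integral_add (hz.integrable_divIntegrand hN hs0 hs1 hφ h)
      (hz.integrable_divIntegrand hN hs0 hs1 hψ h')]
  congr 2
  ext q
  simp only [divIntegrand]; ring

lemma ae_snd_snd {P : ℝ → Prop} (h : ∀ᵐ t, P t) :
    ∀ᵐ q : Space N × Space N × ℝ, P q.2.2 :=
  (Measure.quasiMeasurePreserving_snd.comp Measure.quasiMeasurePreserving_snd).ae h

/-- Dominated convergence with the common majorant. Convergence is asked only at almost every time
and the limit need not be measurable: time sampling of the defect gives no more. -/
lemma tendsto_fracDiv (hN : 1 ≤ N) (hs0 : 0 < s) (hs1 : s < 1) {I : Set ℝ}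
    {z : Space N × Space N × ℝ → ℝ} (hz : IsUnitField I z) {L R a b : ℝ}
    {Φ : ℕ → Space N × ℝ → ℝ} {φ : Space N × ℝ → ℝ} (hΦ : ∀ n, Measurable (Φ n))
    (h : ∀ n, IsSpatiallyLipschitz L R a b (Φ n))
    (hlim : ∀ᵐ t, ∀ x, Tendsto (fun n => Φ n (x, t)) atTop (𝓝 (φ (x, t)))) :
    Tendsto (fun n => fracDiv s I z (Φ n)) atTop (𝓝 (fracDiv s I z φ)) := by
  simp only [fracDiv_eq]
  refine Tendsto.const_mul _ (tendsto_integral_of_dominated_convergence (divMajorant N s L R a b)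
    (fun n => hz.aestronglyMeasurable_divIntegrand (hΦ n))
    (integrable_divMajorant hN hs0 hs1 L R a b).integrableOn
    (fun n => hz.abs_divIntegrand_le (h n)) ?_)
  refine ae_restrict_of_ae ?_
  filter_upwards [ae_snd_snd hlim] with q hq
  exact (((hq q.1).sub (hq q.2.1)).div_const _).const_mul _

lemma measurableSet_fieldDomain {I : Set ℝ} (hI : MeasurableSet I) :
    MeasurableSet (fieldDomain N I) :=
  hI.preimage (measurable_snd.comp measurable_snd)

/-- Only the times in the support of the test function matter. -/
lemma fracDiv_eq_of_subset {I J : Set ℝ} (hIJ : J ⊆ I)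
    (hI : MeasurableSet I) (z : Space N × Space N × ℝ → ℝ) {φ : Space N × ℝ → ℝ}
    (h : ∀ p, φ p ≠ 0 → p.2 ∈ J) : fracDiv s I z φ = fracDiv s J z φ := by
  rw [fracDiv_eq, fracDiv_eq]
  congr 1
  refine setIntegral_eq_of_subset_of_forall_sdiff_eq_zero (measurableSet_fieldDomain hI)
    (fun q hq => hIJ hq) (fun q hq => ?_)
  have h0 : ∀ x, φ (x, q.2.2) = 0 := fun x => by
    by_contra hne
    exact hq.2 (h (x, q.2.2) hne)
  simp [divIntegrand, h0]

lemma IsUnitField.mono {I J : Set ℝ} (hIJ : J ⊆ I) {z : Space N × Space N × ℝ → ℝ}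
    (hz : IsUnitField I z) : IsUnitField J z :=
  ⟨hz.measurable.mono_measure (Measure.restrict_mono
      (show fieldDomain N J ⊆ fieldDomain N I from fun _ hq => hIJ hq) le_rfl),
    ae_restrict_of_ae_restrict_of_subset
      (show fieldDomain N J ⊆ fieldDomain N I from fun _ hq => hIJ hq) hz.abs_le_one⟩

lemma fracConst_nonneg (hs1 : s < 1) : 0 ≤ fracConst N s :=
  div_nonneg (by linarith) measureReal_nonneg

/-! ### Smooth approximation in space and time -/

open scoped Convolution in
/-- A nonnegative Lipschitz function with compact support is a pointwise limit of smooth ones, with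
the same bounds and with supports in a compact neighbourhood. -/
lemma exists_smooth_approx {χ : Space N → ℝ} {L : ℝ} (h0 : ∀ x, 0 ≤ χ x) (hb : ∀ x, χ x ≤ L)
    (hlip : ∀ x y, |χ x - χ y| ≤ L * ‖x - y‖) {K U : Set (Space N)} (hK : IsCompact K)
    (hU : IsOpen U) (hKU : K ⊆ U) (hsupp : ∀ x, χ x ≠ 0 → x ∈ K) :
    ∃ K' : Set (Space N), IsCompact K' ∧ K' ⊆ U ∧ ∃ χ' : ℕ → Space N → ℝ,
      (∀ n, ContDiff ℝ ∞ (χ' n)) ∧ (∀ n x, 0 ≤ χ' n x) ∧ (∀ n x, χ' n x ≤ L) ∧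
      (∀ n x y, |χ' n x - χ' n y| ≤ L * ‖x - y‖) ∧ (∀ n x, χ' n x ≠ 0 → x ∈ K') ∧
      ∀ x, Tendsto (fun n => χ' n x) atTop (𝓝 (χ x)) := by
  obtain ⟨δ, hδ, hδU⟩ := hK.exists_cthickening_subset_open hU hKU
  have hL : 0 ≤ L := (h0 0).trans (hb 0)
  have hcont : Continuous χ :=
    (LipschitzWith.of_dist_le_mul (K := ⟨L, hL⟩) (fun x y => by
      rw [Real.dist_eq, dist_eq_norm]; exact hlip x y)).continuous
  let b : ℕ → ContDiffBump (0 : Space N) := fun n =>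
    { rIn := δ / (n + 1) / 2, rOut := δ / (n + 1), rIn_pos := by positivity,
      rIn_lt_rOut := half_lt_self (by positivity) }
  let w : ℕ → Space N → ℝ := fun n => (b n).normed volume
  have hw0 : ∀ n t, 0 ≤ w n t := fun n t => (b n).nonneg_normed t
  have hwc : ∀ n, Continuous (w n) := fun n => (b n).continuous_normed
  have hwi : ∀ n, Integrable (w n) := fun n => (b n).integrable_normed
  have hw1 : ∀ n, ∫ t, w n t = 1 := fun n => (b n).integral_normed
  have hint : ∀ n x, Integrable fun t => w n t * χ (x - t) := fun n x => by
    refine ((hwi n).mul_const L).mono' (by fun_prop) (Eventually.of_forall fun t => ?_)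
    rw [Real.norm_eq_abs, abs_of_nonneg (mul_nonneg (hw0 n t) (h0 _))]
    exact mul_le_mul_of_nonneg_left (hb _) (hw0 n t)
  have heq : ∀ n x, (w n ⋆[ContinuousLinearMap.lsmul ℝ ℝ, volume] χ) x =
      ∫ t, w n t * χ (x - t) := fun n x => rfl
  refine ⟨Metric.cthickening δ K, hK.cthickening, hδU,
    fun n => w n ⋆[ContinuousLinearMap.lsmul ℝ ℝ, volume] χ, fun n => ?_, fun n x => ?_,
    fun n x => ?_, fun n x y => ?_, fun n x hx => ?_, fun x => ?_⟩
  · exact (b n).hasCompactSupport_normed.contDiff_convolution_left _ (b n).contDiff_normed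
      hcont.locallyIntegrable
  · simp only [heq]
    exact integral_nonneg fun t => mul_nonneg (hw0 n t) (h0 _)
  · simp only [heq]
    calc ∫ t, w n t * χ (x - t) ≤ ∫ t, w n t * L :=
          integral_mono (hint n x) ((hwi n).mul_const L)
            fun t => mul_le_mul_of_nonneg_left (hb _) (hw0 n t)
      _ = L := by rw [integral_mul_const, hw1, one_mul]
  · simp only [heq]
    rw [← integral_sub (hint n x) (hint n y), ← Real.norm_eq_abs]
    calc ‖∫ t, (w n t * χ (x - t) - w n t * χ (y - t))‖ ≤ ∫ t, w n t * (L * ‖x - y‖) := by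
          refine norm_integral_le_of_norm_le ((hwi n).mul_const _) (Eventually.of_forall fun t => ?_)
          rw [← mul_sub, Real.norm_eq_abs, abs_mul, abs_of_nonneg (hw0 n t)]
          refine mul_le_mul_of_nonneg_left ?_ (hw0 n t)
          simpa using hlip (x - t) (y - t)
      _ = L * ‖x - y‖ := by rw [integral_mul_const, hw1, one_mul]
  · by_contra hxK
    refine hx ?_
    simp only [heq]
    refine integral_eq_zero_of_ae (Eventually.of_forall fun t => ?_)
    by_contra hne
    have hwt : w n t ≠ 0 := fun h => hne (by simp [h])
    have hχt : χ (x - t) ≠ 0 := fun h => hne (by simp [h])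
    have ht : t ∈ Metric.ball (0 : Space N) (δ / (n + 1)) := by
      rw [show Metric.ball (0 : Space N) (δ / (n + 1)) = Function.support (w n) from
        (b n).support_normed_eq.symm]
      exact hwt
    refine hxK (Metric.mem_cthickening_of_dist_le x (x - t) δ K (hsupp _ hχt) ?_)
    rw [dist_eq_norm, sub_sub_cancel]
    rw [mem_ball_zero_iff] at ht
    refine ht.le.trans (div_le_self hδ.le (by linarith [Nat.cast_nonneg (α := ℝ) n]))
  · exact ContDiffBump.convolution_tendsto_right_of_continuous (φ := b)
      (tendsto_const_nhds.div_atTop (tendsto_natCast_atTop_atTop.atTop_add tendsto_const_nhds))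
      hcont x

/-- A smooth monotone step from `0` to `1` on the interval `[t - 1 / m, t]`. -/
def smoothStep (m t σ : ℝ) : ℝ := Real.smoothTransition (m * (σ - t) + 1)

lemma contDiff_smoothStep (m t : ℝ) : ContDiff ℝ ∞ (smoothStep m t) :=
  Real.smoothTransition.contDiff.comp (by fun_prop)

lemma monotone_smoothStep {m : ℝ} (hm : 0 ≤ m) (t : ℝ) : Monotone (smoothStep m t) :=
  fun _ _ h => Real.smoothTransition.monotone (by gcongr)

lemma smoothStep_of_le {m t σ : ℝ} (hm : 0 < m) (h : σ ≤ t - 1 / m) : smoothStep m t σ = 0 := by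
  refine Real.smoothTransition.zero_of_nonpos ?_
  have : m * (σ - t) ≤ m * (-(1 / m)) := mul_le_mul_of_nonneg_left (by linarith) hm.le
  rw [mul_neg, mul_one_div_cancel hm.ne'] at this
  linarith

lemma smoothStep_of_ge {m t σ : ℝ} (hm : 0 ≤ m) (h : t ≤ σ) : smoothStep m t σ = 1 :=
  Real.smoothTransition.one_of_one_le (by nlinarith)

lemma tendsto_smoothStep {m : ℕ → ℝ} (hm : Tendsto m atTop atTop) (t σ : ℝ) :
    Tendsto (fun n => smoothStep (m n) t σ) atTop (𝓝 ((Ici t).indicator 1 σ)) := by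
  by_cases h : t ≤ σ
  · rw [indicator_of_mem (by exact h)]
    refine tendsto_const_nhds.congr' ?_
    filter_upwards [hm.eventually_ge_atTop 0] with n hn
    rw [smoothStep_of_ge hn h]; rfl
  · rw [indicator_of_notMem (by exact h)]
    push Not at h
    refine tendsto_const_nhds.congr' ?_
    filter_upwards [hm.eventually_ge_atTop (1 / (t - σ)), hm.eventually_gt_atTop 0] with n hn hn0
    rw [smoothStep_of_le hn0]
    have : 1 / m n ≤ t - σ := by
      rw [div_le_comm₀ hn0 (by linarith)]; exact hn
    linarith

lemma deriv_smoothStep_eq_zero {m t σ : ℝ} (hm : 0 < m) (hσ : σ ∉ Icc (t - 1 / m) t) :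
    deriv (smoothStep m t) σ = 0 := by
  rw [mem_Icc, not_and_or, not_le, not_le] at hσ
  rcases hσ with h | h
  · have : smoothStep m t =ᶠ[𝓝 σ] fun _ => 0 := by
      filter_upwards [Iio_mem_nhds h] with r hr using smoothStep_of_le hm (le_of_lt hr)
    rw [this.deriv_eq]; simp
  · have : smoothStep m t =ᶠ[𝓝 σ] fun _ => 1 := by
      filter_upwards [Ioi_mem_nhds h] with r hr using smoothStep_of_ge hm.le (le_of_lt hr)
    rw [this.deriv_eq]; simp

/-- Integrating against the derivatives of smooth steps recovers the left limit. -/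
lemma tendsto_integral_deriv_smoothStep_mul {m : ℕ → ℝ} (hm : Tendsto m atTop atTop) {t η : ℝ}
    (hη : 0 < η) {g : ℝ → ℝ} (hg : IntegrableOn g (Ioo (t - η) t)) {c : ℝ}
    (hc : Tendsto g (𝓝[<] t) (𝓝 c)) :
    Tendsto (fun n => ∫ σ, deriv (smoothStep (m n) t) σ * g σ) atTop (𝓝 c) := by
  have hout : ∀ n, 0 < m n → ∀ σ, σ ∉ Icc (t - 1 / m n) t → deriv (smoothStep (m n) t) σ = 0 :=
    fun n hn σ hσ => deriv_smoothStep_eq_zero hn hσ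
  have hev : ∀ ε > 0, ∀ᶠ n in atTop, 0 < m n ∧ 1 / m n < ε := by
    intro ε hε
    filter_upwards [hm.eventually_gt_atTop (1 / ε), hm.eventually_gt_atTop 0] with n h1 h2
    refine ⟨h2, ?_⟩
    rw [div_lt_comm₀ h2 hε]; exact h1
  have hcd : ∀ n, Continuous (deriv (smoothStep (m n) t)) := fun n =>
    (contDiff_smoothStep (m n) t).continuous_deriv (by simp)
  -- The derivatives are nonnegative, have mass one and concentrate on `[t - 1 / m, t]`: an
  -- approximate identity acting from the left of `t`.
  have key := tendsto_setIntegral_peak_smul_of_integrableOn_of_tendsto (μ := volume)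
    (φ := fun n => deriv (smoothStep (m n) t)) (l := atTop) (x₀ := t) (s := Ioo (t - η) t)
    (t := Ioo (t - η) t) (g := g) (a := c) measurableSet_Ioo measurableSet_Ioo subset_rfl
    self_mem_nhdsWithin (by simp) ?_ ?_ ?_
    (Eventually.of_forall fun n => (hcd n).aestronglyMeasurable) hg
    (hc.mono_left (nhdsWithin_mono _ fun x hx => hx.2))
  · refine key.congr' ?_
    filter_upwards [hev η hη] with n hn
    rw [← integral_Icc_eq_integral_Ioo]
    refine setIntegral_eq_integral_of_forall_compl_eq_zero fun σ hσ => ?_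
    have : σ ∉ Icc (t - 1 / m n) t := fun h => hσ ⟨by linarith [h.1, hn.2], h.2⟩
    simp [hout n hn.1 σ this]
  · filter_upwards [hm.eventually_ge_atTop 0] with n hn σ _
    exact (monotone_smoothStep hn t).deriv_nonneg
  · intro u hu htu
    obtain ⟨ε, hε, hball⟩ := Metric.isOpen_iff.1 hu t htu
    rw [Metric.tendstoUniformlyOn_iff]
    intro e he
    filter_upwards [hev ε hε] with n hn σ hσ
    have : σ ∉ Icc (t - 1 / m n) t := fun h => hσ.2 (hball (by
      rw [Metric.mem_ball, Real.dist_eq, abs_lt]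
      exact ⟨by linarith [h.1, hn.2], by linarith [h.2]⟩))
    simp [hout n hn.1 σ this, he]
  · refine tendsto_const_nhds.congr' ?_
    filter_upwards [hev η hη] with n hn
    rw [← integral_Ioc_eq_integral_Ioo, ← intervalIntegral.integral_of_le (by linarith),
      intervalIntegral.integral_deriv_eq_sub
        (fun x _ => (contDiff_smoothStep (m n) t).differentiable (by simp) x)
        ((hcd n).intervalIntegrable _ _),
      smoothStep_of_ge hn.1.le le_rfl, smoothStep_of_le hn.1 (by linarith [hn.2]), sub_zero]

/-! ### From distributional inequalities to increments in time -/

lemma tendsto_integral_mul_left {χ : Space N → ℝ} (hχ : Continuous χ) {K : Set (Space N)}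
    (hK : IsCompact K) (hsupp : ∀ x, χ x ≠ 0 → x ∈ K) {u : Space N × ℝ → ℝ} {t : ℝ}
    (hu_lip : ∀ᶠ r in 𝓝[<] t, ∀ x y, |u (x, r) - u (y, r)| ≤ ‖x - y‖)
    (hu_left : ∀ x, Tendsto (fun r => u (x, r)) (𝓝[<] t) (𝓝 (u (x, t)))) :
    Tendsto (fun r => ∫ x, χ x * u (x, r)) (𝓝[<] t) (𝓝 (∫ x, χ x * u (x, t))) := by
  have hcs : HasCompactSupport χ :=
    HasCompactSupport.intro hK fun x hx => by_contra fun h => hx (hsupp x h)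
  have hcont : ∀ r, (∀ x y, |u (x, r) - u (y, r)| ≤ ‖x - y‖) → Continuous fun x => u (x, r) :=
    fun r hr => (LipschitzWith.of_dist_le_mul (K := 1) (fun x y => by
      rw [Real.dist_eq, dist_eq_norm, NNReal.coe_one, one_mul]; exact hr x y)).continuous
  refine tendsto_integral_filter_of_dominated_convergence
    (fun x => |χ x| * (|u (0, t)| + 1 + ‖x‖)) ?_ ?_ ?_ ?_
  · filter_upwards [hu_lip] with r hr
    exact (hχ.mul (hcont r hr)).aestronglyMeasurable
  · have h1 : ∀ᶠ r in 𝓝[<] t, |u (0, r)| < |u (0, t)| + 1 :=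
      (hu_left 0).abs.eventually_lt_const (by linarith)
    filter_upwards [hu_lip, h1] with r hr h1
    refine Eventually.of_forall fun x => ?_
    rw [Real.norm_eq_abs, abs_mul]
    refine mul_le_mul_of_nonneg_left ?_ (abs_nonneg _)
    have h2 := hr x 0
    rw [sub_zero] at h2
    have h3 := abs_sub_abs_le_abs_sub (u (x, r)) (u (0, r))
    linarith
  · exact Continuous.integrable_of_hasCompactSupport (by fun_prop) (hcs.abs.mul_right)
  · exact Eventually.of_forall fun x => (hu_left x).const_mul _

lemma deriv_smooth_product (c m t₁ t₂ σ : ℝ) :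
    deriv (fun τ => (smoothStep m t₁ τ - smoothStep m t₂ τ) * c) σ =
      (deriv (smoothStep m t₁) σ - deriv (smoothStep m t₂) σ) * c := by
  have hd : ∀ t, DifferentiableAt ℝ (smoothStep m t) σ := fun t =>
    (contDiff_smoothStep m t).differentiable (by simp) σ
  exact (((hd t₁).hasDerivAt.sub (hd t₂).hasDerivAt).mul_const c).deriv

/-- A function dominating a fractional divergence in the sense of distributions, tested with a
smooth function of space on a time interval. -/
lemma fracDiv_le_of_smooth (hN : 1 ≤ N) (hs0 : 0 < s) (hs1 : s < 1) {J : Set ℝ} (hJ : IsOpen J)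
    {z : Space N × Space N × ℝ → ℝ} (hz : IsUnitField J z) {U : Set (Space N)}
    {u : Space N × ℝ → ℝ} (hu_int : LocallyIntegrableOn u (U ×ˢ J))
    (hu_lip : ∀ t ∈ J, ∀ x y, |u (x, t) - u (y, t)| ≤ ‖x - y‖)
    (hu_left : ∀ t ∈ J, ∀ x, Tendsto (fun r => u (x, r)) (𝓝[<] t) (𝓝 (u (x, t))))
    (hu : ∀ φ : Space N × ℝ → ℝ, IsTestFunction (U ×ˢ J) φ → (∀ p, 0 ≤ φ p) →
      fracDiv s J z φ ≤ -∫ p, u p * deriv (fun τ => φ (p.1, τ)) p.2)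
    {χ : Space N → ℝ} {L : ℝ} (hχ : ContDiff ℝ ∞ χ) (h0 : ∀ x, 0 ≤ χ x) (hb : ∀ x, χ x ≤ L)
    (hlip : ∀ x y, |χ x - χ y| ≤ L * ‖x - y‖) {K : Set (Space N)} (hK : IsCompact K)
    (hKU : K ⊆ U) (hsupp : ∀ x, χ x ≠ 0 → x ∈ K) {t₁ t₂ : ℝ} (h12 : t₁ < t₂)
    (htJ : Icc t₁ t₂ ⊆ J) :
    fracDiv s J z (fun p => (Ico t₁ t₂).indicator 1 p.2 * χ p.1) ≤
      ∫ x, χ x * (u (x, t₂) - u (x, t₁)) := by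
  have hL : 0 ≤ L := (h0 0).trans (hb 0)
  have hcs : HasCompactSupport χ :=
    HasCompactSupport.intro hK fun x hx => by_contra fun h => hx (hsupp x h)
  obtain ⟨R, hR⟩ := hK.isBounded.exists_norm_le
  obtain ⟨η, hη, hηJ⟩ : ∃ η > 0, Icc (t₁ - η) t₂ ⊆ J := by
    obtain ⟨η, hη, hb⟩ := Metric.isOpen_iff.1 hJ t₁ (htJ ⟨le_rfl, h12.le⟩)
    refine ⟨η / 2, by positivity, fun σ hσ => ?_⟩
    rcases le_total t₁ σ with h | h
    · exact htJ ⟨h, hσ.2⟩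
    · refine hb ?_
      rw [Metric.mem_ball, Real.dist_eq, abs_lt]
      constructor <;> linarith [hσ.1]
  have ht1J : t₁ ∈ J := htJ ⟨le_rfl, h12.le⟩
  have ht2J : t₂ ∈ J := htJ ⟨h12.le, le_rfl⟩
  -- The steps rise before `t₁` and `t₂`, so as to see left limits. The shift `1 / η` makes each
  -- rise last at most `η`, which keeps the supports inside `J` for every `n`.
  let m : ℕ → ℝ := fun n => n + 1 / η
  have hmpos : ∀ n, 0 < m n := fun n => by positivity
  have hm : Tendsto m atTop atTop :=
    tendsto_natCast_atTop_atTop.atTop_add tendsto_const_nhds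
  have hmη : ∀ n, 1 / m n ≤ η := fun n => by
    rw [div_le_comm₀ (hmpos n) hη]
    exact le_add_of_nonneg_left (Nat.cast_nonneg n)
  let ρ : ℕ → ℝ → ℝ := fun n σ => smoothStep (m n) t₁ σ - smoothStep (m n) t₂ σ
  have hρ0 : ∀ n σ, 0 ≤ ρ n σ := fun n σ => sub_nonneg.2 <|
    Real.smoothTransition.monotone (by have := hmpos n; gcongr)
  have hρ1 : ∀ n σ, ρ n σ ≤ 1 := fun n σ => by
    have h1 : smoothStep (m n) t₁ σ ≤ 1 := Real.smoothTransition.le_one _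
    have h2 : 0 ≤ smoothStep (m n) t₂ σ := Real.smoothTransition.nonneg _
    simp only [ρ]; linarith
  have hρs : ∀ n σ, ρ n σ ≠ 0 → σ ∈ Icc (t₁ - η) t₂ := fun n σ h => by
    by_contra hσ
    rw [mem_Icc, not_and_or, not_le, not_le] at hσ
    refine h ?_
    rcases hσ with hσ | hσ
    · simp only [ρ]
      rw [smoothStep_of_le (hmpos n) (by linarith [hmη n]),
        smoothStep_of_le (hmpos n) (by linarith [hmη n]), sub_zero]
    · simp only [ρ]
      rw [smoothStep_of_ge (hmpos n).le (by linarith),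
        smoothStep_of_ge (hmpos n).le hσ.le, sub_self]
  have hρc : ∀ n, ContDiff ℝ ∞ (ρ n) := fun n =>
    (contDiff_smoothStep _ _).sub (contDiff_smoothStep _ _)
  let Φ : ℕ → Space N × ℝ → ℝ := fun n p => ρ n p.2 * χ p.1
  have hΦs : ∀ n p, Φ n p ≠ 0 → p ∈ K ×ˢ Icc (t₁ - η) t₂ := fun n p h =>
    ⟨hsupp _ (right_ne_zero_of_mul h), hρs n _ (left_ne_zero_of_mul h)⟩
  have hΦc : ∀ n, ContDiff ℝ ∞ (Φ n) := fun n =>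
    ((hρc n).comp contDiff_snd).mul (hχ.comp contDiff_fst)
  have hcpt : IsCompact (K ×ˢ Icc (t₁ - η) t₂) := hK.prod isCompact_Icc
  have hsub : K ×ˢ Icc (t₁ - η) t₂ ⊆ U ×ˢ J := prod_mono hKU hηJ
  have hts : ∀ n, tsupport (Φ n) ⊆ K ×ˢ Icc (t₁ - η) t₂ := fun n =>
    closure_minimal (fun p hp => hΦs n p hp) hcpt.isClosed
  have hΦtest : ∀ n, IsTestFunction (U ×ˢ J) (Φ n) := fun n =>
    ⟨hΦc n, hcpt.of_isClosed_subset (isClosed_tsupport _) (hts n), (hts n).trans hsub⟩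
  have hΦL : ∀ n, IsSpatiallyLipschitz L R (t₁ - η) t₂ (Φ n) := fun n => by
    refine ⟨fun p => ?_, fun x y t => ?_, fun p hp => ⟨hR _ (hΦs n p hp).1, (hΦs n p hp).2⟩⟩
    · rw [abs_of_nonneg (mul_nonneg (hρ0 _ _) (h0 _))]
      exact (mul_le_of_le_one_left (h0 _) (hρ1 _ _)).trans (hb _)
    · simp only [Φ]
      rw [← mul_sub, abs_mul, abs_of_nonneg (hρ0 _ _)]
      exact (mul_le_of_le_one_left (abs_nonneg _) (hρ1 _ _)).trans (hlip x y)
  have hlimΛ : Tendsto (fun n => fracDiv s J z (Φ n)) atTop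
      (𝓝 (fracDiv s J z (fun p => (Ico t₁ t₂).indicator 1 p.2 * χ p.1))) := by
    refine tendsto_fracDiv hN hs0 hs1 hz (fun n => (hΦc n).continuous.measurable) hΦL
      (Eventually.of_forall fun t x => ?_)
    refine Tendsto.mul_const _ ?_
    have h := (tendsto_smoothStep hm t₁ t).sub (tendsto_smoothStep hm t₂ t)
    convert h using 2
    by_cases h1 : t₁ ≤ t
    · by_cases h2 : t₂ ≤ t
      · simp [indicator, h1, h2]
      · simp [indicator, h1, h2, not_le.1 h2]
    · have h2 : ¬ t₂ ≤ t := fun h => h1 (h12.le.trans h)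
      simp [indicator, h1, h2]
  -- the right-hand sides
  let g : ℝ → ℝ := fun σ => ∫ x, χ x * u (x, σ)
  have hprod : Integrable (fun p : Space N × ℝ => χ p.1 * u p)
      ((volume : Measure (Space N)).prod (volume.restrict (Icc (t₁ - η) t₂))) := by
    have h1 : IntegrableOn u (K ×ˢ Icc (t₁ - η) t₂) := hu_int.integrableOn_compact_subset hsub hcpt
    have h2 : IntegrableOn (fun p : Space N × ℝ => χ p.1 * u p) (K ×ˢ Icc (t₁ - η) t₂) :=
      
      h1.continuousOn_mul (hχ.continuous.comp continuous_fst).continuousOn hcpt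
    have h3 : IntegrableOn (fun p : Space N × ℝ => χ p.1 * u p) (univ ×ˢ Icc (t₁ - η) t₂) := by
      refine h2.of_forall_sdiff_eq_zero (MeasurableSet.univ.prod measurableSet_Icc) ?_
      intro p hp
      have : χ p.1 = 0 := by_contra fun h => hp.2 ⟨hsupp _ h, hp.1.2⟩
      simp [this]
    rw [IntegrableOn, Measure.volume_eq_prod, ← Measure.prod_restrict, Measure.restrict_univ] at h3
    exact h3
  have hg : IntegrableOn g (Icc (t₁ - η) t₂) := hprod.integral_prod_right
  have hgl : ∀ t ∈ J, Tendsto g (𝓝[<] t) (𝓝 (g t)) := fun t ht =>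
    tendsto_integral_mul_left hχ.continuous hK hsupp
      (by filter_upwards [nhdsWithin_le_nhds (hJ.mem_nhds ht)] with r hr using hu_lip r hr)
      (hu_left t ht)
  have hd : ∀ n t, Continuous (deriv (smoothStep (m n) t)) := fun n t =>
    (contDiff_smoothStep (m n) t).continuous_deriv (by simp)
  have hk : ∀ n, ∀ t ∈ Icc t₁ t₂, ∀ σ ∉ Icc (t₁ - η) t₂, deriv (smoothStep (m n) t) σ = 0 :=
    fun n t ht σ hσ => deriv_smoothStep_eq_zero (hmpos n)
      fun h => hσ ⟨by linarith [h.1, hmη n, ht.1], h.2.trans ht.2⟩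
  have hkg : ∀ n, ∀ t ∈ Icc t₁ t₂,
      ∫ σ in Icc (t₁ - η) t₂, deriv (smoothStep (m n) t) σ * g σ =
        ∫ σ, deriv (smoothStep (m n) t) σ * g σ := fun n t ht =>
    setIntegral_eq_integral_of_forall_compl_eq_zero fun σ hσ => by simp [hk n t ht σ hσ]
  have h1mem : t₁ ∈ Icc t₁ t₂ := ⟨le_rfl, h12.le⟩
  have h2mem : t₂ ∈ Icc t₁ t₂ := ⟨h12.le, le_rfl⟩
  -- By Fubini, the pairing with the time derivative reduces to pairing `g` with the derivatives of
  -- the two steps, which tend to point evaluations at `t₂` and `t₁`.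
  have hrhs : ∀ n, -∫ p, u p * deriv (fun τ => Φ n (p.1, τ)) p.2 =
      (∫ σ, deriv (smoothStep (m n) t₂) σ * g σ) - ∫ σ, deriv (smoothStep (m n) t₁) σ * g σ := by
    intro n
    let κ : ℝ → ℝ := fun σ => deriv (smoothStep (m n) t₁) σ - deriv (smoothStep (m n) t₂) σ
    have hκ : Continuous κ := (hd n t₁).sub (hd n t₂)
    have e1 : ∀ p : Space N × ℝ, u p * deriv (fun τ => Φ n (p.1, τ)) p.2 =
        κ p.2 * (χ p.1 * u p) := fun p => by
      simp only [Φ, ρ, κ]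
      rw [deriv_smooth_product]; ring
    have e2 : ∫ p, κ p.2 * (χ p.1 * u p) =
        ∫ p, κ p.2 * (χ p.1 * u p)
          ∂((volume : Measure (Space N)).prod (volume.restrict (Icc (t₁ - η) t₂))) := by
      rw [← Measure.restrict_univ (μ := (volume : Measure (Space N))), Measure.prod_restrict,
        ← Measure.volume_eq_prod]
      refine (setIntegral_eq_integral_of_forall_compl_eq_zero fun p hp => ?_).symm
      have : p.2 ∉ Icc (t₁ - η) t₂ := fun h => hp ⟨trivial, h⟩
      simp [κ, hk n _ h1mem _ this, hk n _ h2mem _ this]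
    have e3 : Integrable (fun p : Space N × ℝ => κ p.2 * (χ p.1 * u p))
        ((volume : Measure (Space N)).prod (volume.restrict (Icc (t₁ - η) t₂))) := by
      obtain ⟨C, hC⟩ := isCompact_Icc.exists_bound_of_continuousOn (s := Icc (t₁ - η) t₂)
        hκ.continuousOn
      have hC' : ∀ σ, ‖κ σ‖ ≤ max C 0 := fun σ => by
        by_cases hσ : σ ∈ Icc (t₁ - η) t₂
        · exact (hC σ hσ).trans (le_max_left _ _)
        · simp [κ, hk n _ h1mem _ hσ, hk n _ h2mem _ hσ]
      exact hprod.bdd_mul (hκ.comp continuous_snd).aestronglyMeasurable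
        (Eventually.of_forall fun p => hC' p.2)
    have e4 : ∀ t, IntegrableOn (fun σ => deriv (smoothStep (m n) t) σ * g σ)
        (Icc (t₁ - η) t₂) := fun t => hg.continuousOn_mul (hd n t).continuousOn isCompact_Icc
    simp only [e1]
    rw [e2, integral_prod_symm _ e3]
    simp only [integral_const_mul]
    rw [← hkg n _ h1mem, ← hkg n _ h2mem, ← integral_sub (e4 t₂) (e4 t₁), ← integral_neg]
    congr 1
    ext σ
    simp only [κ, g]; ring
  have hlim : Tendsto (fun n => -∫ p, u p * deriv (fun τ => Φ n (p.1, τ)) p.2) atTop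
      (𝓝 (g t₂ - g t₁)) := by
    simp only [hrhs]
    refine (tendsto_integral_deriv_smoothStep_mul hm (η := t₂ - t₁) (by linarith)
      (hg.mono_set fun σ hσ => ⟨by linarith [hσ.1], hσ.2.le⟩) (hgl t₂ ht2J)).sub
      (tendsto_integral_deriv_smoothStep_mul hm hη
      (hg.mono_set fun σ hσ => ⟨hσ.1.le, by linarith [hσ.2]⟩) (hgl t₁ ht1J))
  have hint : ∀ t ∈ J, Integrable fun x => χ x * u (x, t) := fun t ht => by
    have hcont : Continuous fun x => u (x, t) :=
      (LipschitzWith.of_dist_le_mul (K := 1) (fun x y => by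
        rw [Real.dist_eq, dist_eq_norm, NNReal.coe_one, one_mul]
        exact hu_lip t ht x y)).continuous
    exact (hχ.continuous.mul hcont).integrable_of_hasCompactSupport hcs.mul_right
  calc _ ≤ g t₂ - g t₁ := le_of_tendsto_of_tendsto' hlimΛ hlim fun n =>
        hu (Φ n) (hΦtest n) fun p => mul_nonneg (hρ0 _ _) (h0 _)
    _ = _ := by
      simp only [g]
      rw [← integral_sub (hint t₂ ht2J) (hint t₁ ht1J)]
      simp only [mul_sub]

/-- The same for Lipschitz functions of space. -/
lemma fracDiv_le_of_lipschitz (hN : 1 ≤ N) (hs0 : 0 < s) (hs1 : s < 1) {J : Set ℝ} (hJ : IsOpen J)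
    {z : Space N × Space N × ℝ → ℝ} (hz : IsUnitField J z) {U : Set (Space N)} (hU : IsOpen U)
    {u : Space N × ℝ → ℝ} (hu_int : LocallyIntegrableOn u (U ×ˢ J))
    (hu_lip : ∀ t ∈ J, ∀ x y, |u (x, t) - u (y, t)| ≤ ‖x - y‖)
    (hu_left : ∀ t ∈ J, ∀ x, Tendsto (fun r => u (x, r)) (𝓝[<] t) (𝓝 (u (x, t))))
    (hu : ∀ φ : Space N × ℝ → ℝ, IsTestFunction (U ×ˢ J) φ → (∀ p, 0 ≤ φ p) →
      fracDiv s J z φ ≤ -∫ p, u p * deriv (fun τ => φ (p.1, τ)) p.2)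
    {χ : Space N → ℝ} {L : ℝ} (h0 : ∀ x, 0 ≤ χ x) (hb : ∀ x, χ x ≤ L)
    (hlip : ∀ x y, |χ x - χ y| ≤ L * ‖x - y‖) {K : Set (Space N)} (hK : IsCompact K)
    (hKU : K ⊆ U) (hsupp : ∀ x, χ x ≠ 0 → x ∈ K) {t₁ t₂ : ℝ} (h12 : t₁ < t₂)
    (htJ : Icc t₁ t₂ ⊆ J) :
    fracDiv s J z (fun p => (Ico t₁ t₂).indicator 1 p.2 * χ p.1) ≤
      ∫ x, χ x * (u (x, t₂) - u (x, t₁)) := by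
  obtain ⟨K', hK', hK'U, χ', hc, hnn, hle, hl, hs, hlim⟩ :=
    exists_smooth_approx h0 hb hlip hK hU hKU hsupp
  obtain ⟨R, hR⟩ := hK'.isBounded.exists_norm_le
  have hind0 : ∀ t, 0 ≤ (Ico t₁ t₂).indicator (1 : ℝ → ℝ) t :=
    fun t => indicator_nonneg (fun _ _ => zero_le_one) _
  have hind1 : ∀ t, (Ico t₁ t₂).indicator (1 : ℝ → ℝ) t ≤ 1 :=
    fun t => indicator_le_self' (fun _ _ => zero_le_one) _
  have hcont : ∀ t ∈ J, Continuous fun x => u (x, t) := fun t ht =>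
    (LipschitzWith.of_dist_le_mul (K := 1) (fun x y => by
      rw [Real.dist_eq, dist_eq_norm, NNReal.coe_one, one_mul]
      exact hu_lip t ht x y)).continuous
  have hc1 := hcont t₁ (htJ ⟨le_rfl, h12.le⟩)
  have hc2 := hcont t₂ (htJ ⟨h12.le, le_rfl⟩)
  refine le_of_tendsto_of_tendsto' (b := atTop)
    (f := fun n => fracDiv s J z (fun p => (Ico t₁ t₂).indicator 1 p.2 * χ' n p.1))
    (g := fun n => ∫ x, χ' n x * (u (x, t₂) - u (x, t₁))) ?_ ?_ fun n =>
    fracDiv_le_of_smooth hN hs0 hs1 hJ hz hu_int hu_lip hu_left hu (hc n) (hnn n) (hle n) (hl n)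
      hK' hK'U (hs n) h12 htJ
  · refine tendsto_fracDiv hN hs0 hs1 hz (L := L) (R := R) (a := t₁) (b := t₂) (fun n => ?_)
      (fun n => ⟨fun p => ?_, fun x y t => ?_, fun p hp => ⟨?_, ?_⟩⟩)
      (Eventually.of_forall fun t x => (hlim x).const_mul _)
    · exact ((measurable_one.indicator measurableSet_Ico).comp measurable_snd).mul
        ((hc n).continuous.measurable.comp measurable_fst)
    · rw [abs_of_nonneg (mul_nonneg (hind0 _) (hnn _ _))]
      exact (mul_le_of_le_one_left (hnn _ _) (hind1 _)).trans (hle _ _)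
    · rw [← mul_sub, abs_mul, abs_of_nonneg (hind0 _)]
      exact (mul_le_of_le_one_left (abs_nonneg _) (hind1 _)).trans (hl n x y)
    · exact hR _ (hs n _ (right_ne_zero_of_mul hp))
    · exact Ico_subset_Icc_self (mem_of_indicator_ne_zero (left_ne_zero_of_mul hp))
  · refine tendsto_integral_of_dominated_convergence
      (K'.indicator fun x => L * |u (x, t₂) - u (x, t₁)|) (fun n => ?_) ?_ (fun n => ?_) ?_
    · exact ((hc n).continuous.mul (hc2.sub hc1)).aestronglyMeasurable
    · rw [integrable_indicator_iff hK'.isClosed.measurableSet]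
      exact (continuous_const.mul (hc2.sub hc1).abs).continuousOn.integrableOn_compact hK'
    · refine Eventually.of_forall fun x => ?_
      by_cases hx : x ∈ K'
      · rw [indicator_of_mem hx, Real.norm_eq_abs, abs_mul, abs_of_nonneg (hnn n x)]
        exact mul_le_mul_of_nonneg_right (hle n x) (abs_nonneg _)
      · have : χ' n x = 0 := by_contra fun h => hx (hs n x h)
        simp [this, hx]
    · exact Eventually.of_forall fun x => (hlim x).mul_const _

/-! ### A smoothed positive part -/

/-- The slope of the smoothed positive part. -/
def clampSlope (ε r : ℝ) : ℝ := max 0 (min 1 ((r + ε) / (2 * ε)))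

/-- A convex function of class `C^{1,1}` which equals the positive part outside `(-ε, ε)`. -/
def softPos (ε r : ℝ) : ℝ := clampSlope ε r * r + ε * (clampSlope ε r - clampSlope ε r ^ 2)

lemma clampSlope_nonneg (ε r : ℝ) : 0 ≤ clampSlope ε r := le_max_left _ _

lemma clampSlope_le_one (ε r : ℝ) : clampSlope ε r ≤ 1 := max_le zero_le_one (min_le_left _ _)

lemma abs_clampSlope_sub_le {ε : ℝ} (hε : 0 < ε) (a b : ℝ) :
    |clampSlope ε a - clampSlope ε b| ≤ 1 / (2 * ε) * |a - b| := by
  have h1 := abs_max_sub_max_le_abs (min 1 ((a + ε) / (2 * ε))) (min 1 ((b + ε) / (2 * ε))) 0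
  have h2 := abs_min_sub_min_le_max 1 ((a + ε) / (2 * ε)) 1 ((b + ε) / (2 * ε))
  rw [sub_self, abs_zero, max_eq_right (abs_nonneg _)] at h2
  have h3 : (a + ε) / (2 * ε) - (b + ε) / (2 * ε) = 1 / (2 * ε) * (a - b) := by ring
  rw [h3, abs_mul, abs_of_pos (a := 1 / (2 * ε)) (by positivity)] at h2
  rw [clampSlope, clampSlope, max_comm 0, max_comm 0]
  exact h1.trans h2

/-- `softPos ε r` is the maximum over `θ ∈ [0, 1]` of the affine functions `θ r + ε (θ - θ²)` of
`r`, attained at `θ = clampSlope ε r`. In the unclamped case the gap is `ε (clampSlope ε r - θ)²`.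
Convexity and all bounds below follow from this. -/
lemma le_softPos {ε : ℝ} (hε : 0 < ε) {θ : ℝ} (h0 : 0 ≤ θ) (h1 : θ ≤ 1) (r : ℝ) :
    θ * r + ε * (θ - θ ^ 2) ≤ softPos ε r := by
  rw [softPos, clampSlope]
  rcases le_total ((r + ε) / (2 * ε)) 0 with h | h
  · rw [max_eq_left ((min_le_right _ _).trans h)]
    rw [div_nonpos_iff] at h
    have : r + ε ≤ 0 := by
      rcases h with h | h
      · linarith
      · exact h.1
    nlinarith [mul_nonneg h0 (neg_nonneg.2 this), mul_nonneg hε.le (sq_nonneg θ)]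
  · rcases le_total ((r + ε) / (2 * ε)) 1 with h' | h'
    · rw [min_eq_right h', max_eq_right h]
      set k := (r + ε) / (2 * ε) with hk
      have hr : r = 2 * ε * k - ε := by rw [hk]; field_simp; ring
      rw [hr]
      nlinarith [mul_nonneg hε.le (sq_nonneg (k - θ))]
    · rw [min_eq_left h', max_eq_right zero_le_one]
      rw [one_le_div (by positivity)] at h'
      nlinarith [mul_nonneg (sub_nonneg.2 h1) (sub_nonneg.2 h'), mul_nonneg hε.le (sq_nonneg (1 - θ))]

/-- The slope that is optimal at `a` is a competitor at `b`. -/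
lemma softPos_tangent {ε : ℝ} (hε : 0 < ε) (a b : ℝ) :
    softPos ε a + clampSlope ε a * (b - a) ≤ softPos ε b := by
  have h := le_softPos hε (clampSlope_nonneg ε a) (clampSlope_le_one ε a) b
  have e : softPos ε a = clampSlope ε a * a + ε * (clampSlope ε a - clampSlope ε a ^ 2) := rfl
  linarith

lemma le_softPos_self {ε : ℝ} (hε : 0 < ε) (r : ℝ) : r ≤ softPos ε r := by
  simpa using le_softPos hε zero_le_one le_rfl r

lemma softPos_nonneg {ε : ℝ} (hε : 0 < ε) (r : ℝ) : 0 ≤ softPos ε r := by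
  simpa using le_softPos hε le_rfl zero_le_one r

lemma softPos_of_le {ε r : ℝ} (hε : 0 < ε) (h : ε ≤ r) : softPos ε r = r := by
  have : 1 ≤ (r + ε) / (2 * ε) := by rw [one_le_div (by positivity)]; linarith
  rw [softPos, clampSlope, min_eq_left this, max_eq_right zero_le_one]
  ring

lemma monotone_softPos {ε : ℝ} (hε : 0 < ε) : Monotone (softPos ε) := fun a b hab => by
  have h1 := softPos_tangent hε a b
  have h2 := mul_nonneg (clampSlope_nonneg ε a) (sub_nonneg.2 hab)
  linarith

lemma softPos_sub_le {ε : ℝ} (hε : 0 < ε) (a b : ℝ) : softPos ε a - softPos ε b ≤ |a - b| := by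
  have h1 := softPos_tangent hε a b
  have h2 : clampSlope ε a * (a - b) ≤ |a - b| := by
    refine (mul_le_mul_of_nonneg_left (le_abs_self _) (clampSlope_nonneg ε a)).trans ?_
    exact mul_le_of_le_one_left (abs_nonneg _) (clampSlope_le_one ε a)
  linarith

lemma abs_softPos_sub_le {ε : ℝ} (hε : 0 < ε) (a b : ℝ) :
    |softPos ε a - softPos ε b| ≤ |a - b| := by
  rw [abs_le]
  have h1 := softPos_sub_le hε a b
  have h2 := softPos_sub_le hε b a
  rw [abs_sub_comm] at h2
  constructor <;> linarith

/-- The smoothed maximum of `c` and `r`. -/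
def softMax (ε c r : ℝ) : ℝ := c + softPos ε (r - c)

lemma le_softMax_left {ε : ℝ} (hε : 0 < ε) (c r : ℝ) : c ≤ softMax ε c r :=
  le_add_of_nonneg_right (softPos_nonneg hε _)

lemma le_softMax_right {ε : ℝ} (hε : 0 < ε) (c r : ℝ) : r ≤ softMax ε c r := by
  have := le_softPos_self hε (r - c)
  rw [softMax]; linarith

lemma softMax_le {ε : ℝ} (hε : 0 < ε) (c r : ℝ) : softMax ε c r ≤ max (c + ε) r := by
  rw [softMax]
  rcases le_total ε (r - c) with h | h
  · rw [softPos_of_le hε h]; simp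
  · have := monotone_softPos hε h
    rw [softPos_of_le hε le_rfl] at this
    exact le_max_of_le_left (by linarith)

lemma monotone_softMax {ε : ℝ} (hε : 0 < ε) (c : ℝ) : Monotone (softMax ε c) := fun a b h => by
  have := monotone_softPos hε (sub_le_sub_right h c)
  rw [softMax, softMax]; linarith

lemma abs_softMax_sub_le {ε : ℝ} (hε : 0 < ε) (c a b : ℝ) :
    |softMax ε c a - softMax ε c b| ≤ |a - b| := by
  have := abs_softPos_sub_le hε (a - c) (b - c)
  rw [softMax, softMax, add_sub_add_left_eq_sub]
  simpa using this

lemma continuous_softMax {ε : ℝ} (hε : 0 < ε) : Continuous fun p : ℝ × ℝ => softMax ε p.1 p.2 := by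
  have : Continuous (softPos ε) := (LipschitzWith.of_dist_le_mul (K := 1) fun a b => by
    simpa [Real.dist_eq] using abs_softPos_sub_le hε a b).continuous
  exact continuous_fst.add (this.comp (continuous_snd.sub continuous_fst))

lemma softMax_tangent {ε : ℝ} (hε : 0 < ε) (c a c' a' : ℝ) :
    clampSlope ε (a - c) * (a' - a) + (1 - clampSlope ε (a - c)) * (c' - c) ≤
      softMax ε c' a' - softMax ε c a := by
  have := softPos_tangent hε (a - c) (a' - c')
  rw [softMax, softMax]; linarith

/-! ### Increments of truncated supersolutions -/

/-- A function, Lipschitz in space and left continuous in time, which is a supersolution with a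
calibrating field whose divergence is at most `C`, in a cylinder. -/
structure IsLocalSupersolution (s C : ℝ) (U : Set (Space N)) (J : Set ℝ) (d : Space N × ℝ → ℝ)
    (z : Space N × Space N × ℝ → ℝ) : Prop where
  field : IsUnitField J z
  locallyIntegrableOn : LocallyIntegrableOn d (U ×ˢ J)
  nonneg : ∀ p, 0 ≤ d p
  abs_sub_le : ∀ t x y, |d (x, t) - d (y, t)| ≤ ‖x - y‖
  left_continuous : ∀ t ∈ J, ∀ x, Tendsto (fun r => d (x, r)) (𝓝[<] t) (𝓝 (d (x, t)))
  supersolution : ∀ φ : Space N × ℝ → ℝ, IsTestFunction (U ×ˢ J) φ → (∀ p, 0 ≤ φ p) →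
    fracDiv s J z φ ≤ -∫ p, d p * deriv (fun τ => φ (p.1, τ)) p.2
  fracDiv_le : ∀ φ : Space N × ℝ → ℝ, IsTestFunction (U ×ˢ J) φ → (∀ p, 0 ≤ φ p) →
    fracDiv s J z φ ≤ -∫ p : Space N × ℝ, C * p.2 * deriv (fun τ => φ (p.1, τ)) p.2
  calibrated : ∀ᵐ q ∂(volume.restrict (fieldDomain N J)),
    z q * (d (q.1, q.2.2) - d (q.2.1, q.2.2)) = |d (q.1, q.2.2) - d (q.2.1, q.2.2)|

lemma isSpatiallyLipschitz_indicator_mul {χ : Space N → ℝ} {L R : ℝ} (h0 : ∀ x, 0 ≤ χ x)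
    (hb : ∀ x, χ x ≤ L) (hlip : ∀ x y, |χ x - χ y| ≤ L * ‖x - y‖) (hR : ∀ x, χ x ≠ 0 → ‖x‖ ≤ R)
    (t₁ t₂ : ℝ) :
    IsSpatiallyLipschitz L R t₁ t₂
      (fun p : Space N × ℝ => (Ico t₁ t₂).indicator 1 p.2 * χ p.1) := by
  have hind0 : ∀ t, 0 ≤ (Ico t₁ t₂).indicator (1 : ℝ → ℝ) t :=
    fun t => indicator_nonneg (fun _ _ => zero_le_one) _
  have hind1 : ∀ t, (Ico t₁ t₂).indicator (1 : ℝ → ℝ) t ≤ 1 :=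
    fun t => indicator_le_self' (fun _ _ => zero_le_one) _
  refine ⟨fun p => ?_, fun x y t => ?_, fun p hp => ⟨?_, ?_⟩⟩
  · rw [abs_of_nonneg (mul_nonneg (hind0 _) (h0 _))]
    exact (mul_le_of_le_one_left (h0 _) (hind1 _)).trans (hb _)
  · rw [← mul_sub, abs_mul, abs_of_nonneg (hind0 _)]
    exact (mul_le_of_le_one_left (abs_nonneg _) (hind1 _)).trans (hlip x y)
  · exact hR _ (right_ne_zero_of_mul hp)
  · exact Ico_subset_Icc_self (mem_of_indicator_ne_zero (left_ne_zero_of_mul hp))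

lemma continuous_of_abs_sub_le {χ : Space N → ℝ} {L : ℝ} (hL : 0 ≤ L)
    (hlip : ∀ x y, |χ x - χ y| ≤ L * ‖x - y‖) : Continuous χ :=
  (LipschitzWith.of_dist_le_mul (K := ⟨L, hL⟩) (fun x y => by
    rw [Real.dist_eq, dist_eq_norm]; exact hlip x y)).continuous

lemma measurable_indicator_mul {χ : Space N → ℝ} (hχ : Measurable χ) (t₁ t₂ : ℝ) :
    Measurable (fun p : Space N × ℝ => (Ico t₁ t₂).indicator (1 : ℝ → ℝ) p.2 * χ p.1) :=
  ((measurable_one.indicator measurableSet_Ico).comp measurable_snd).mul (hχ.comp measurable_fst)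

/-- Split `χ = χ θ + χ (1 - θ)`, with `θ` the slope of the smoothed maximum at the initial time.
Test the inequality for `d` with the first part and that for `C t` with the second. By convexity,
the resulting combination lies below the increment of the smoothed maximum, without error term. The
smoothing makes `θ` Lipschitz, hence `χ θ` admissible; the slope of a true maximum would jump. -/
lemma IsLocalSupersolution.fracDiv_le_softMax (hN : 1 ≤ N) (hs0 : 0 < s) (hs1 : s < 1) {C : ℝ}
    {U : Set (Space N)} (hU : IsOpen U) {J : Set ℝ} (hJ : IsOpen J) {d : Space N × ℝ → ℝ}
    {z : Space N × Space N × ℝ → ℝ} (hd : IsLocalSupersolution s C U J d z) {ε : ℝ} (hε : 0 < ε)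
    {χ : Space N → ℝ} {L : ℝ} (h0 : ∀ x, 0 ≤ χ x) (hb : ∀ x, χ x ≤ L)
    (hlip : ∀ x y, |χ x - χ y| ≤ L * ‖x - y‖) {K : Set (Space N)} (hK : IsCompact K)
    (hKU : K ⊆ U) (hsupp : ∀ x, χ x ≠ 0 → x ∈ K) {t₁ t₂ : ℝ} (h12 : t₁ < t₂)
    (htJ : Icc t₁ t₂ ⊆ J) {c₁ c₂ : ℝ} (hc : c₂ - c₁ = C * (t₂ - t₁)) :
    fracDiv s J z (fun p => (Ico t₁ t₂).indicator 1 p.2 * χ p.1) ≤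
      ∫ x, χ x * (softMax ε c₂ (d (x, t₂)) - softMax ε c₁ (d (x, t₁))) := by
  have hL : 0 ≤ L := (h0 0).trans (hb 0)
  obtain ⟨R, hR⟩ := hK.isBounded.exists_norm_le
  have ht1 : t₁ ∈ J := htJ ⟨le_rfl, h12.le⟩
  have ht2 : t₂ ∈ J := htJ ⟨h12.le, le_rfl⟩
  have hcs : HasCompactSupport χ :=
    HasCompactSupport.intro hK fun x hx => by_contra fun h => hx (hsupp x h)
  let θ : Space N → ℝ := fun x => clampSlope ε (d (x, t₁) - c₁)
  have hθ0 : ∀ x, 0 ≤ θ x := fun x => clampSlope_nonneg _ _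
  have hθ1 : ∀ x, θ x ≤ 1 := fun x => clampSlope_le_one _ _
  have hθl : ∀ x y, |θ x - θ y| ≤ 1 / (2 * ε) * ‖x - y‖ := fun x y => by
    refine (abs_clampSlope_sub_le hε _ _).trans (mul_le_mul_of_nonneg_left ?_ (by positivity))
    rw [sub_sub_sub_cancel_right]
    exact hd.abs_sub_le t₁ x y
  let L' : ℝ := L * (1 + 1 / (2 * ε))
  have hLL' : L ≤ L' := le_mul_of_one_le_right hL (by have : 0 ≤ 1 / (2 * ε) := by positivity
                                                      linarith)
  have hmul : ∀ w : Space N → ℝ, (∀ x, 0 ≤ w x) → (∀ x, w x ≤ 1) →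
      (∀ x y, |w x - w y| ≤ 1 / (2 * ε) * ‖x - y‖) →
      (∀ x, 0 ≤ χ x * w x) ∧ (∀ x, χ x * w x ≤ L') ∧
      (∀ x y, |χ x * w x - χ y * w y| ≤ L' * ‖x - y‖) ∧ (∀ x, χ x * w x ≠ 0 → x ∈ K) := by
    intro w hw0 hw1 hwl
    refine ⟨fun x => mul_nonneg (h0 x) (hw0 x), fun x => ?_, fun x y => ?_,
      fun x hx => hsupp x (left_ne_zero_of_mul hx)⟩
    · exact (mul_le_of_le_one_right (h0 x) (hw1 x)).trans ((hb x).trans hLL')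
    · have e : χ x * w x - χ y * w y = (χ x - χ y) * w x + χ y * (w x - w y) := by ring
      rw [e]
      refine (abs_add_le _ _).trans ?_
      rw [abs_mul, abs_mul, abs_of_nonneg (hw0 x), abs_of_nonneg (h0 y)]
      have e1 : |χ x - χ y| * w x ≤ L * ‖x - y‖ :=
        (mul_le_of_le_one_right (abs_nonneg _) (hw1 x)).trans (hlip x y)
      have e2 : χ y * |w x - w y| ≤ L * (1 / (2 * ε) * ‖x - y‖) :=
        mul_le_mul (hb y) (hwl x y) (abs_nonneg _) hL
      calc _ ≤ L * ‖x - y‖ + L * (1 / (2 * ε) * ‖x - y‖) := add_le_add e1 e2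
        _ = L' * ‖x - y‖ := by simp only [L']; ring
  obtain ⟨a0, ab, al, as⟩ := hmul θ hθ0 hθ1 hθl
  obtain ⟨b0, bb, bl, bs⟩ := hmul (fun x => 1 - θ x) (fun x => sub_nonneg.2 (hθ1 x))
    (fun x => by linarith [hθ0 x]) (fun x y => by
      rw [sub_sub_sub_cancel_left, abs_sub_comm]; exact hθl x y)
  have hL' : 0 ≤ L' := hL.trans hLL'
  have hac := continuous_of_abs_sub_le hL' al
  have hbc := continuous_of_abs_sub_le hL' bl
  have hχc := continuous_of_abs_sub_le hL hlip
  have hdc : ∀ t ∈ J, Continuous fun x => d (x, t) := fun t ht =>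
    continuous_of_abs_sub_le zero_le_one (by simpa using hd.abs_sub_le t)
  have hsc : ∀ t ∈ J, ∀ c, Continuous fun x => softMax ε c (d (x, t)) := fun t ht c =>
    (continuous_softMax hε).comp (continuous_const.prodMk (hdc t ht))
  have hA := fracDiv_le_of_lipschitz hN hs0 hs1 hJ hd.field hU hd.locallyIntegrableOn
    (fun t _ => hd.abs_sub_le t) hd.left_continuous hd.supersolution a0 ab al hK hKU as h12 htJ
  have hB := fracDiv_le_of_lipschitz hN hs0 hs1 hJ hd.field hU (u := fun p => C * p.2)
    ((continuous_const.mul continuous_snd).locallyIntegrable.locallyIntegrableOn _)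
    (fun t _ x y => by simp) (fun t _ x => (Continuous.tendsto (by fun_prop) t).mono_left
      nhdsWithin_le_nhds) hd.fracDiv_le b0 bb bl hK hKU bs h12 htJ
  have hsum := fracDiv_add hN hs0 hs1 hd.field
    (measurable_indicator_mul hac.measurable t₁ t₂)
    (isSpatiallyLipschitz_indicator_mul a0 ab al (fun x hx => hR x (as x hx)) t₁ t₂)
    (measurable_indicator_mul hbc.measurable t₁ t₂)
    (isSpatiallyLipschitz_indicator_mul b0 bb bl (fun x hx => hR x (bs x hx)) t₁ t₂)
  have hcs1 : HasCompactSupport fun x => χ x * θ x := hcs.mul_right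
  have hcs2 : HasCompactSupport fun x => χ x * (1 - θ x) := hcs.mul_right
  have i1 : Integrable fun x => χ x * θ x * (d (x, t₂) - d (x, t₁)) :=
    (hac.mul ((hdc t₂ ht2).sub (hdc t₁ ht1))).integrable_of_hasCompactSupport hcs1.mul_right
  have i2 : Integrable fun x => χ x * (1 - θ x) * (C * t₂ - C * t₁) :=
    (hbc.mul continuous_const).integrable_of_hasCompactSupport hcs2.mul_right
  have i3 : Integrable fun x => χ x * (softMax ε c₂ (d (x, t₂)) - softMax ε c₁ (d (x, t₁))) :=
    (hχc.mul ((hsc t₂ ht2 _).sub (hsc t₁ ht1 _))).integrable_of_hasCompactSupport hcs.mul_right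
  calc _ = fracDiv s J z (fun p => (Ico t₁ t₂).indicator 1 p.2 * (χ p.1 * θ p.1) +
        (Ico t₁ t₂).indicator 1 p.2 * (χ p.1 * (1 - θ p.1))) := by
        congr 1; ext p; ring
    _ ≤ _ := hsum.le.trans (add_le_add hA hB)
    _ = ∫ x, (χ x * θ x * (d (x, t₂) - d (x, t₁)) + χ x * (1 - θ x) * (C * t₂ - C * t₁)) :=
        (integral_add i1 i2).symm
    _ ≤ _ := by
      refine integral_mono (i1.add i2) i3 fun x => ?_
      have h := mul_le_mul_of_nonneg_left (softMax_tangent hε c₁ (d (x, t₁)) c₂ (d (x, t₂))) (h0 x)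
      rw [hc] at h
      refine le_trans (le_of_eq ?_) h
      simp only [θ]; ring

/-! ### Left continuous functions of time -/

/-- A real function which is left continuous on a set is right continuous at all but countably many
of its points. -/
lemma countable_not_tendsto_right {J : Set ℝ} {g : ℝ → ℝ}
    (hg : ∀ t ∈ J, Tendsto g (𝓝[<] t) (𝓝 (g t))) :
    {t ∈ J | ¬ Tendsto g (𝓝[>] t) (𝓝 (g t))}.Countable := by
  -- For the index `(n, l, q)`: on `(l, t]` the function stays within `1 / (2 (n + 1))` of `q`, yet
  -- arbitrarily close to the right of `t` it is at least `1 / (n + 1)` away from `g t`. Two such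
  -- times `t < t'` are incompatible, since the closeness for `t'` covers the points just after `t`.
  let A : ℕ × ℚ × ℚ → Set ℝ := fun i =>
    {t | (i.2.1 : ℝ) < t ∧ (∀ σ ∈ Ioc (i.2.1 : ℝ) t, |g σ - i.2.2| < 1 / (i.1 + 1) / 2) ∧
      ∃ᶠ r in 𝓝[>] t, 1 / ((i.1 : ℝ) + 1) ≤ |g r - g t|}
  have hA : ∀ i, (A i).Countable := fun i => by
    refine Set.Subsingleton.countable fun t ht t' ht' => ?_
    have key : ∀ t ∈ A i, ∀ t' ∈ A i, ¬ t < t' := by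
      rintro t ⟨h1, h2, h3⟩ t' ⟨_, h5, _⟩ hlt
      refine h3 ?_
      filter_upwards [Ioo_mem_nhdsGT hlt] with r hr
      have e1 := abs_lt.1 (h5 r ⟨h1.trans hr.1, hr.2.le⟩)
      have e2 := abs_lt.1 (h2 t ⟨h1, le_rfl⟩)
      rw [not_le, abs_lt]
      constructor <;> linarith [e1.1, e1.2, e2.1, e2.2]
    exact le_antisymm (not_lt.1 (key t' ht' t ht)) (not_lt.1 (key t ht t' ht'))
  refine (countable_iUnion hA).mono fun t ht => ?_
  obtain ⟨htJ, hnt⟩ := ht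
  rw [Metric.tendsto_nhds] at hnt
  push Not at hnt
  obtain ⟨e, he, hfreq⟩ := hnt
  obtain ⟨n, hn⟩ := exists_nat_one_div_lt he
  have hpos : (0 : ℝ) < 1 / (n + 1) / 2 := by positivity
  obtain ⟨q, hq1, hq2⟩ := exists_rat_btwn (show g t - 1 / (n + 1) / 2 < g t by linarith)
  have hev : ∀ᶠ r in 𝓝[<] t, |g r - q| < 1 / (n + 1) / 2 := by
    refine ((hg t htJ).sub_const (q : ℝ)).abs.eventually_lt_const ?_
    rw [abs_of_pos (by linarith)]; linarith
  obtain ⟨l, hl, hlt⟩ := (mem_nhdsLT_iff_exists_Ioo_subset).1 hev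
  obtain ⟨l', hl1, hl2⟩ := exists_rat_btwn (show l < t from hl)
  refine mem_iUnion.2 ⟨(n, l', q), hl2, fun σ hσ => ?_, ?_⟩
  · rcases hσ.2.eq_or_lt with h | h
    · rw [h, abs_of_pos (by simp only; linarith)]; simp only; linarith
    · exact hlt ⟨hl1.trans hσ.1, h⟩
  · refine hfreq.mono fun r hr => ?_
    rw [Real.dist_eq] at hr
    exact hn.le.trans (by simpa using hr)

/-- A function which is Lipschitz in space and left continuous in time is, at almost every time,
right continuous in time at all points of space. -/
lemma ae_tendsto_right {J : Set ℝ} {d : Space N × ℝ → ℝ}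
    (hlip : ∀ t ∈ J, ∀ x y, |d (x, t) - d (y, t)| ≤ ‖x - y‖) (hJ : IsOpen J)
    (hleft : ∀ t ∈ J, ∀ x, Tendsto (fun r => d (x, r)) (𝓝[<] t) (𝓝 (d (x, t)))) :
    ∀ᵐ t, t ∈ J → ∀ x, Tendsto (fun r => d (x, r)) (𝓝[>] t) (𝓝 (d (x, t))) := by
  -- One exceptional null set serves all points of space: discard countably many times for each
  -- point of a dense sequence, then extend by the uniform Lipschitz bound.
  let e := TopologicalSpace.denseSeq (Space N)
  have hc : (⋃ k, {t ∈ J | ¬ Tendsto (fun r => d (e k, r)) (𝓝[>] t) (𝓝 (d (e k, t)))}).Countable :=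
    countable_iUnion fun k => countable_not_tendsto_right fun t ht => hleft t ht (e k)
  filter_upwards [hc.ae_notMem volume] with t ht htJ x
  have hk : ∀ k, Tendsto (fun r => d (e k, r)) (𝓝[>] t) (𝓝 (d (e k, t))) := fun k => by
    by_contra h
    exact ht (mem_iUnion.2 ⟨k, htJ, h⟩)
  rw [Metric.tendsto_nhds]
  intro ε hε
  obtain ⟨k, hkx⟩ := (TopologicalSpace.denseRange_denseSeq (Space N)).exists_dist_lt x
    (show 0 < ε / 3 by positivity)
  rw [dist_eq_norm] at hkx
  filter_upwards [Metric.tendsto_nhds.1 (hk k) (ε / 3) (by positivity),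
    nhdsWithin_le_nhds (hJ.mem_nhds htJ)] with r hr hrJ
  rw [Real.dist_eq] at hr ⊢
  have h1 := abs_le.1 (hlip r hrJ x (e k))
  have h2 := abs_le.1 (hlip t htJ x (e k))
  have h3 := abs_lt.1 hr
  rw [abs_lt]
  constructor <;> linarith [h1.1, h1.2, h2.1, h2.2, h3.1, h3.2]

/-! ### The comparison functional -/

/-- The truncated defect `(D - f_E - f_G)^+` of two distance functions. -/
def defect (D ε : ℝ) (c : ℝ → ℝ) (d d' : Space N × ℝ → ℝ) (p : Space N × ℝ) : ℝ :=
  max 0 (D - (softMax ε (c p.2) (d p) + softMax ε (c p.2) (d' p)))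

lemma defect_nonneg (D ε : ℝ) (c : ℝ → ℝ) (d d' : Space N × ℝ → ℝ) (p : Space N × ℝ) :
    0 ≤ defect D ε c d d' p := le_max_left _ _

lemma defect_le {D ε : ℝ} (hD : 0 ≤ D) (hε : 0 < ε) (c : ℝ → ℝ) {d d' : Space N × ℝ → ℝ}
    (hd : ∀ p, 0 ≤ d p) (hd' : ∀ p, 0 ≤ d' p) (p : Space N × ℝ) : defect D ε c d d' p ≤ D := by
  refine max_le hD ?_
  have h1 := (hd p).trans (le_softMax_right hε (c p.2) (d p))
  have h2 := (hd' p).trans (le_softMax_right hε (c p.2) (d' p))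
  linarith

lemma abs_defect_sub_le {D ε : ℝ} (hε : 0 < ε) (c : ℝ → ℝ) {d d' : Space N × ℝ → ℝ} {t : ℝ}
    (hd : ∀ x y, |d (x, t) - d (y, t)| ≤ ‖x - y‖)
    (hd' : ∀ x y, |d' (x, t) - d' (y, t)| ≤ ‖x - y‖) (x y : Space N) :
    |defect D ε c d d' (x, t) - defect D ε c d d' (y, t)| ≤ 2 * ‖x - y‖ := by
  rw [defect, defect, max_comm, max_comm 0]
  refine (abs_max_sub_max_le_abs _ _ _).trans ?_
  have h1 := abs_le.1 ((abs_softMax_sub_le hε (c t) (d (x, t)) (d (y, t))).trans (hd x y))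
  have h2 := abs_le.1 ((abs_softMax_sub_le hε (c t) (d' (x, t)) (d' (y, t))).trans (hd' x y))
  rw [abs_le]
  constructor <;> simp only <;> linarith [h1.1, h1.2, h2.1, h2.2]

lemma defect_anti {D ε : ℝ} (hε : 0 < ε) (c : ℝ → ℝ) {d d' : Space N × ℝ → ℝ} {t : ℝ}
    {x y : Space N} (h : d (x, t) ≤ d (y, t)) (h' : d' (x, t) ≤ d' (y, t)) :
    defect D ε c d d' (y, t) ≤ defect D ε c d d' (x, t) := by
  have h1 := monotone_softMax hε (c t) h
  have h2 := monotone_softMax hε (c t) h'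
  refine max_le_max le_rfl ?_
  simp only; linarith

/-- The calibration inequality: the fields of the two distances point against the defect. -/
lemma calibration_nonpos {a b a' b' ζ ζ' T : ℝ} (hζ : |ζ| ≤ 1) (hζ' : |ζ'| ≤ 1)
    (h : ζ * (a - b) = |a - b|) (h' : ζ' * (a' - b') = |a' - b'|)
    (hT₁ : a ≤ b → a' ≤ b' → 0 ≤ T) (hT₂ : b ≤ a → b' ≤ a' → T ≤ 0) :
    ζ * T + ζ' * T ≤ 0 := by
  obtain ⟨l, u⟩ := abs_le.1 hζ
  obtain ⟨l', u'⟩ := abs_le.1 hζ'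
  have sgn : ∀ {a b ζ : ℝ}, ζ * (a - b) = |a - b| → (a < b → ζ = -1) ∧ (b < a → ζ = 1) := by
    intro a b ζ h
    constructor
    · intro hab
      rw [abs_of_neg (by linarith)] at h
      have : (ζ + 1) * (a - b) = 0 := by linarith
      rcases mul_eq_zero.1 this with h | h <;> linarith
    · intro hab
      rw [abs_of_pos (by linarith)] at h
      have : (ζ - 1) * (a - b) = 0 := by linarith
      rcases mul_eq_zero.1 this with h | h <;> linarith
  obtain ⟨s1, s2⟩ := sgn h
  obtain ⟨s1', s2'⟩ := sgn h'
  -- Opposite strict orders give `ζ + ζ' = 0`. Otherwise `T` has a known sign, each field with a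
  -- strict increment equals `±1` against that sign, and a field with zero increment is controlled
  -- by `|ζ| ≤ 1`.
  rcases lt_trichotomy a b with hab | hab | hab <;> rcases lt_trichotomy a' b' with hab' | hab' | hab'
  · have := hT₁ hab.le hab'.le; rw [s1 hab, s1' hab']; linarith
  · have := hT₁ hab.le hab'.le; rw [s1 hab]; nlinarith
  · rw [s1 hab, s2' hab']; linarith
  · have := hT₁ hab.le hab'.le; rw [s1' hab']; nlinarith
  · have := hT₁ hab.le hab'.le; have := hT₂ hab.ge hab'.ge
    have : T = 0 := by linarith
    simp [this]
  · have := hT₂ hab.ge hab'.le; rw [s2' hab']; nlinarith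
  · rw [s2 hab, s1' hab']; linarith
  · have := hT₂ hab.le hab'.ge; rw [s2 hab]; nlinarith
  · have := hT₂ hab.le hab'.le; rw [s2 hab, s2' hab']; linarith

/-- Convexity of the square of the positive part, with the tangent taken at the later value `b`. -/
lemma sq_defect_sub_le (D a b : ℝ) :
    max 0 (D - b) ^ 2 - max 0 (D - a) ^ 2 ≤ -2 * (max 0 (D - b) * (b - a)) := by
  rcases le_total (D - b) 0 with h | h
  · rw [max_eq_left h]; nlinarith [sq_nonneg (max 0 (D - a))]
  · rw [max_eq_right h]
    have h1 : D - a ≤ max 0 (D - a) := le_max_right _ _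
    nlinarith [sq_nonneg (D - b - max 0 (D - a)), mul_nonneg h (sub_nonneg.2 h1)]

/-- The defect at the final time `t₂` is the test function: convexity of the square bounds the
increment by its pairing with the increments of the two truncated distances, and these are bounded
below by the fractional divergences. -/
lemma sq_defect_increment (hN : 1 ≤ N) (hs0 : 0 < s) (hs1 : s < 1) {C : ℝ}
    {U : Set (Space N)} (hU : IsOpen U) {J : Set ℝ} (hJ : IsOpen J) {d d' : Space N × ℝ → ℝ}
    {z z' : Space N × Space N × ℝ → ℝ} (hd : IsLocalSupersolution s C U J d z)
    (hd' : IsLocalSupersolution s C U J d' z') {D ε : ℝ} (hD : 0 ≤ D) (hε : 0 < ε) {c : ℝ → ℝ}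
    (hc : ∀ t₁ t₂, c t₂ - c t₁ = C * (t₂ - t₁)) {K : Set (Space N)} (hK : IsCompact K)
    (hKU : K ⊆ U) (hsupp : ∀ t ∈ J, ∀ x, defect D ε c d d' (x, t) ≠ 0 → x ∈ K)
    {t₁ t₂ : ℝ} (h12 : t₁ < t₂) (htJ : Icc t₁ t₂ ⊆ J) :
    (∫ x, defect D ε c d d' (x, t₂) ^ 2) - ∫ x, defect D ε c d d' (x, t₁) ^ 2 ≤
      -2 * (fracDiv s J z
          (fun p => (Ico t₁ t₂).indicator 1 p.2 * defect D ε c d d' (p.1, t₂)) +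
        fracDiv s J z'
          (fun p => (Ico t₁ t₂).indicator 1 p.2 * defect D ε c d d' (p.1, t₂))) := by
  have ht1 : t₁ ∈ J := htJ ⟨le_rfl, h12.le⟩
  have ht2 : t₂ ∈ J := htJ ⟨h12.le, le_rfl⟩
  let χ : Space N → ℝ := fun x => defect D ε c d d' (x, t₂)
  have hlip : ∀ t x y, |defect D ε c d d' (x, t) - defect D ε c d d' (y, t)| ≤
      2 * ‖x - y‖ := fun t =>
    abs_defect_sub_le hε c (hd.abs_sub_le t) (hd'.abs_sub_le t)
  have h0 : ∀ x, 0 ≤ χ x := fun x => defect_nonneg _ _ _ _ _ _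
  -- A single constant must bound both the values, at most `D`, and the Lipschitz constant, which is
  -- `2`.
  have hb : ∀ x, χ x ≤ max 2 D := fun x =>
    (defect_le hD hε c hd.nonneg hd'.nonneg _).trans (le_max_right _ _)
  have hl : ∀ x y, |χ x - χ y| ≤ max 2 D * ‖x - y‖ := fun x y =>
    (hlip t₂ x y).trans (mul_le_mul_of_nonneg_right (le_max_left _ _) (norm_nonneg _))
  have hA := hd.fracDiv_le_softMax hN hs0 hs1 hU hJ hε h0 hb hl hK hKU (hsupp t₂ ht2) h12 htJ
    (hc t₁ t₂)
  have hB := hd'.fracDiv_le_softMax hN hs0 hs1 hU hJ hε h0 hb hl hK hKU (hsupp t₂ ht2) h12 htJ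
    (hc t₁ t₂)
  have hcs : ∀ t ∈ J, HasCompactSupport fun x => defect D ε c d d' (x, t) := fun t ht =>
    HasCompactSupport.intro hK fun x hx => by_contra fun h => hx (hsupp t ht x h)
  have hcont : ∀ t, Continuous fun x => defect D ε c d d' (x, t) := fun t =>
    continuous_of_abs_sub_le zero_le_two (hlip t)
  have hsq : ∀ t ∈ J, Integrable fun x => defect D ε c d d' (x, t) ^ 2 := fun t ht =>
    ((hcont t).pow 2).integrable_of_hasCompactSupport (by
      simp only [pow_two]; exact (hcs t ht).mul_right)
  have hdc : ∀ {δ : Space N × ℝ → ℝ}, (∀ t x y, |δ (x, t) - δ (y, t)| ≤ ‖x - y‖) →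
      ∀ t, Continuous fun x => softMax ε (c t) (δ (x, t)) := fun hδ t =>
    (continuous_softMax hε).comp (continuous_const.prodMk
      (continuous_of_abs_sub_le zero_le_one (by simpa using hδ t)))
  have hi : ∀ {δ : Space N × ℝ → ℝ}, (∀ t x y, |δ (x, t) - δ (y, t)| ≤ ‖x - y‖) →
      Integrable fun x => χ x * (softMax ε (c t₂) (δ (x, t₂)) - softMax ε (c t₁) (δ (x, t₁))) :=
    fun hδ => ((hcont t₂).mul ((hdc hδ t₂).sub
      (hdc hδ t₁))).integrable_of_hasCompactSupport (hcs t₂ ht2).mul_right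
  have i1 := hi hd.abs_sub_le
  have i2 := hi hd'.abs_sub_le
  rw [← integral_sub (hsq t₂ ht2) (hsq t₁ ht1)]
  calc _ ≤ ∫ x, -2 * (χ x * (softMax ε (c t₂) (d (x, t₂)) - softMax ε (c t₁) (d (x, t₁))) +
        χ x * (softMax ε (c t₂) (d' (x, t₂)) - softMax ε (c t₁) (d' (x, t₁)))) := by
        refine integral_mono ((hsq t₂ ht2).sub (hsq t₁ ht1)) ((i1.add i2).const_mul _) fun x => ?_
        refine (sq_defect_sub_le D _ _).trans (le_of_eq ?_)
        simp only [χ, defect]; ring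
    _ ≤ _ := by
      rw [integral_const_mul, integral_add i1 i2]
      linarith

/-! ### Time discretization -/

/-- The first point after `σ` of the grid of mesh `h` starting at `a`. -/
def stepTime (a h σ : ℝ) : ℝ := a + h * (⌊(σ - a) / h⌋₊ + 1)

lemma lt_stepTime {a h : ℝ} (hh : 0 < h) (σ : ℝ) : σ < stepTime a h σ := by
  have := Nat.lt_floor_add_one ((σ - a) / h)
  rw [div_lt_iff₀ hh] at this
  rw [stepTime]; linarith

lemma stepTime_le {a h σ : ℝ} (hh : 0 < h) (hσ : a ≤ σ) : stepTime a h σ ≤ σ + h := by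
  have := Nat.floor_le (div_nonneg (sub_nonneg.2 hσ) hh.le)
  rw [le_div_iff₀ hh] at this
  rw [stepTime]; linarith

lemma stepTime_eq {a h σ : ℝ} (hh : 0 < h) {m : ℕ} (hσ : σ ∈ Ico (a + h * m) (a + h * (m + 1))) :
    stepTime a h σ = a + h * (m + 1) := by
  have : ⌊(σ - a) / h⌋₊ = m := by
    rw [Nat.floor_eq_iff (div_nonneg (by have := hσ.1; have : 0 ≤ h * (m : ℝ) := by positivity
                                         linarith) hh.le), le_div_iff₀ hh, div_lt_iff₀ hh]
    constructor <;> linarith [hσ.1, hσ.2]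
  rw [stepTime, this]

/-- A function sampled in time on a grid. -/
def sampled (φ : Space N × ℝ → ℝ) (a h T : ℝ) (p : Space N × ℝ) : ℝ :=
  (Ico a T).indicator 1 p.2 * φ (p.1, stepTime a h p.2)

lemma measurable_sampled {φ : Space N × ℝ → ℝ} (hφ : ∀ t, Measurable fun x => φ (x, t))
    (a h T : ℝ) : Measurable (sampled φ a h T) := by
  -- The sampled function sees time only through the integer index of the grid cell, so
  -- measurability in space at each time gives joint measurability.
  have h1 : Measurable fun p : Space N × ℕ => φ (p.1, a + h * (p.2 + 1)) :=
    measurable_from_prod_countable_left fun k =>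
      show Measurable fun x => φ (x, a + h * ((k : ℝ) + 1)) from hφ _
  have h2 : Measurable fun p : Space N × ℝ => (p.1, ⌊(p.2 - a) / h⌋₊) :=
    measurable_fst.prodMk
      (Nat.measurable_floor.comp ((measurable_snd.sub measurable_const).div measurable_const))
  exact ((measurable_one.indicator measurableSet_Ico).comp measurable_snd).mul (h1.comp h2)

lemma isSpatiallyLipschitz_sampled {φ : Space N × ℝ → ℝ} {L R a b h T : ℝ} (hh : 0 < h)
    (hb : ∀ p, |φ p| ≤ L) (hlip : ∀ t x y, |φ (x, t) - φ (y, t)| ≤ L * ‖x - y‖)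
    (hR : ∀ t ∈ Ioc a b, ∀ x, φ (x, t) ≠ 0 → ‖x‖ ≤ R) (hT : T ≤ b)
    (hstep : ∀ σ ∈ Ico a T, stepTime a h σ ≤ b) :
    IsSpatiallyLipschitz L R a b (sampled φ a h T) := by
  have hind0 : ∀ t, 0 ≤ (Ico a T).indicator (1 : ℝ → ℝ) t :=
    fun t => indicator_nonneg (fun _ _ => zero_le_one) _
  have hind1 : ∀ t, (Ico a T).indicator (1 : ℝ → ℝ) t ≤ 1 :=
    fun t => indicator_le_self' (fun _ _ => zero_le_one) _
  refine ⟨fun p => ?_, fun x y t => ?_, fun p hp => ?_⟩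
  · rw [sampled, abs_mul, abs_of_nonneg (hind0 _)]
    exact (mul_le_of_le_one_left (abs_nonneg _) (hind1 _)).trans (hb _)
  · rw [sampled, sampled, ← mul_sub, abs_mul, abs_of_nonneg (hind0 _)]
    exact (mul_le_of_le_one_left (abs_nonneg _) (hind1 _)).trans (hlip _ x y)
  · have ht := mem_of_indicator_ne_zero (left_ne_zero_of_mul hp)
    exact ⟨hR _ ⟨ht.1.trans_lt (lt_stepTime hh _), hstep _ ht⟩ _ (right_ne_zero_of_mul hp),
      ht.1, ht.2.le.trans hT⟩

lemma sampled_succ (φ : Space N × ℝ → ℝ) {a h : ℝ} (hh : 0 < h) (m : ℕ) (p : Space N × ℝ) :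
    sampled φ a h (a + h * (m + 1)) p = sampled φ a h (a + h * m) p +
      (Ico (a + h * m) (a + h * (m + 1))).indicator 1 p.2 * φ (p.1, a + h * (m + 1)) := by
  have hm : a ≤ a + h * m := by have : 0 ≤ h * (m : ℝ) := by positivity
                                linarith
  have hm' : a + h * m ≤ a + h * (m + 1) := by nlinarith
  by_cases h1 : p.2 ∈ Ico (a + h * m) (a + h * (m + 1))
  · have h2 : p.2 ∉ Ico a (a + h * m) := fun h => absurd h.2 (not_lt.2 h1.1)
    have h3 : p.2 ∈ Ico a (a + h * (m + 1)) := ⟨hm.trans h1.1, h1.2⟩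
    simp only [sampled, indicator_of_mem h1, indicator_of_notMem h2, indicator_of_mem h3,
      stepTime_eq hh h1]
    simp
  · rw [indicator_of_notMem h1, zero_mul, add_zero, sampled, sampled]
    congr 1
    by_cases h2 : p.2 ∈ Ico a (a + h * m)
    · rw [indicator_of_mem h2, indicator_of_mem (show p.2 ∈ Ico a (a + h * (m + 1)) from
        ⟨h2.1, h2.2.trans_le hm'⟩)]
    · rw [indicator_of_notMem h2, indicator_of_notMem]
      rintro ⟨h3, h4⟩
      by_cases h5 : p.2 < a + h * m
      · exact h2 ⟨h3, h5⟩
      · exact h1 ⟨not_lt.1 h5, h4⟩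

/-- The `L²` norm of the defect does not increase. -/
theorem integral_sq_defect_le (hN : 1 ≤ N) (hs0 : 0 < s) (hs1 : s < 1) {C : ℝ}
    {U : Set (Space N)} (hU : IsOpen U) {J : Set ℝ} (hJ : IsOpen J) {d d' : Space N × ℝ → ℝ}
    {z z' : Space N × Space N × ℝ → ℝ} (hd : IsLocalSupersolution s C U J d z)
    (hd' : IsLocalSupersolution s C U J d' z') {D ε : ℝ} (hD : 0 ≤ D) (hε : 0 < ε) {c : ℝ → ℝ}
    (hcc : Continuous c) (hc : ∀ t₁ t₂, c t₂ - c t₁ = C * (t₂ - t₁)) {K : Set (Space N)}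
    (hK : IsCompact K) (hKU : K ⊆ U)
    (hsupp : ∀ t ∈ J, ∀ x, defect D ε c d d' (x, t) ≠ 0 → x ∈ K)
    {a b : ℝ} (hab : a < b) (habJ : Icc a b ⊆ J) :
    ∫ x, defect D ε c d d' (x, b) ^ 2 ≤ ∫ x, defect D ε c d d' (x, a) ^ 2 := by
  set φ := defect D ε c d d' with hφ
  obtain ⟨R, hR⟩ := hK.isBounded.exists_norm_le
  have hφ0 : ∀ p, 0 ≤ φ p := defect_nonneg _ _ _ _ _
  have hφb : ∀ p, |φ p| ≤ max 2 D := fun p => by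
    rw [abs_of_nonneg (hφ0 p)]
    exact (defect_le hD hε c hd.nonneg hd'.nonneg _).trans (le_max_right _ _)
  have hφl : ∀ t x y, |φ (x, t) - φ (y, t)| ≤ max 2 D * ‖x - y‖ := fun t x y =>
    (abs_defect_sub_le hε c (hd.abs_sub_le t) (hd'.abs_sub_le t) x y).trans
      (mul_le_mul_of_nonneg_right (le_max_left _ _) (norm_nonneg _))
  have hL : 0 ≤ max 2 D := zero_le_two.trans (le_max_left _ _)
  have hφm : ∀ t, Measurable fun x => φ (x, t) := fun t =>
    (continuous_of_abs_sub_le hL (hφl t)).measurable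
  have hφR : ∀ t ∈ Icc a b, ∀ x, φ (x, t) ≠ 0 → ‖x‖ ≤ R := fun t ht x hx =>
    hR x (hsupp t (habJ ht) x hx)
  let h : ℕ → ℝ := fun n => (b - a) / (n + 1)
  have hh : ∀ n, 0 < h n := fun n => div_pos (sub_pos.2 hab) (by positivity)
  have hhn : ∀ n, a + h n * (n + 1) = b := fun n => by
    simp only [h]; rw [div_mul_cancel₀ _ (by positivity)]; ring
  have hgrid : ∀ n (m : ℕ), m ≤ n + 1 → a + h n * m ≤ b := fun n m hm => by
    rw [← hhn n]
    have : (m : ℝ) ≤ n + 1 := by exact_mod_cast hm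
    have := mul_le_mul_of_nonneg_left this (hh n).le
    linarith
  have hstep : ∀ n (m : ℕ), m ≤ n + 1 → ∀ σ ∈ Ico a (a + h n * m), stepTime a (h n) σ ≤ b := by
    intro n m hm σ hσ
    have h1 : ⌊(σ - a) / h n⌋₊ < m := by
      rw [Nat.floor_lt (div_nonneg (sub_nonneg.2 hσ.1) (hh n).le), div_lt_iff₀ (hh n)]
      linarith [hσ.2]
    have h2 := hgrid n (⌊(σ - a) / h n⌋₊ + 1) (by omega)
    rw [stepTime]
    exact_mod_cast h2
  have hS : ∀ n (m : ℕ), m ≤ n + 1 →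
      IsSpatiallyLipschitz (max 2 D) R a b (sampled φ a (h n) (a + h n * m)) := fun n m hm =>
    isSpatiallyLipschitz_sampled (hh n) hφb hφl (fun t ht => hφR t ⟨ht.1.le, ht.2⟩)
      (hgrid n m hm) (hstep n m hm)
  -- The increments over the first `m` cells telescope on the left; on the right the test functions
  -- add up to the defect sampled at the right end of each cell.
  have hind : ∀ n (m : ℕ), m ≤ n + 1 →
      (∫ x, φ (x, a + h n * m) ^ 2) - ∫ x, φ (x, a) ^ 2 ≤
        -2 * (fracDiv s J z (sampled φ a (h n) (a + h n * m)) +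
          fracDiv s J z' (sampled φ a (h n) (a + h n * m))) := by
    intro n m
    induction m with
    | zero =>
      intro _
      simp [fracDiv, sampled]
    | succ m ih =>
      intro hm
      have ih := ih (by omega)
      have hm0 : a ≤ a + h n * m := by
        have : 0 ≤ h n * (m : ℝ) := mul_nonneg (hh n).le (Nat.cast_nonneg m)
        linarith
      have hlt : a + h n * m < a + h n * (m + 1) := by have := hh n; nlinarith
      have hle := hgrid n (m + 1) hm
      rw [Nat.cast_add, Nat.cast_one] at hle ⊢
      have hinc := sq_defect_increment hN hs0 hs1 hU hJ hd hd' hD hε hc hK hKU hsupp hlt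
        ((Icc_subset_Icc hm0 hle).trans habJ)
      have hadd : ∀ {ζ : Space N × Space N × ℝ → ℝ}, IsUnitField J ζ →
          fracDiv s J ζ (sampled φ a (h n) (a + h n * (m + 1))) =
            fracDiv s J ζ (sampled φ a (h n) (a + h n * m)) +
            fracDiv s J ζ (fun p => (Ico (a + h n * m) (a + h n * (m + 1))).indicator 1 p.2 *
              φ (p.1, a + h n * (m + 1))) := by
        intro ζ hζ
        rw [← fracDiv_add hN hs0 hs1 hζ (measurable_sampled hφm _ _ _) (hS n m (by omega))
          (measurable_indicator_mul (hφm _) _ _)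
          (isSpatiallyLipschitz_indicator_mul (fun x => hφ0 _) (fun x => (le_abs_self _).trans
            (hφb _)) (hφl _) (hφR _ ⟨hm0.trans hlt.le, hle⟩) _ _)]
        congr 1
        ext p
        exact sampled_succ φ (hh n) m p
      rw [hadd hd.field, hadd hd'.field]
      linarith
  let Φ : ℕ → Space N × ℝ → ℝ := fun n => sampled φ a (h n) b
  have hΦL : ∀ n, IsSpatiallyLipschitz (max 2 D) R a b (Φ n) := fun n => by
    have := hS n (n + 1) le_rfl
    rw [Nat.cast_add, Nat.cast_one, hhn n] at this
    exact this
  have hΦm : ∀ n, Measurable (Φ n) := fun n => measurable_sampled hφm _ _ _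
  have hΦle : ∀ n, (∫ x, φ (x, b) ^ 2) - ∫ x, φ (x, a) ^ 2 ≤
      -2 * (fracDiv s J z (Φ n) + fracDiv s J z' (Φ n)) := fun n => by
    have := hind n (n + 1) le_rfl
    rw [Nat.cast_add, Nat.cast_one, hhn n] at this
    exact this
  let ψ : Space N × ℝ → ℝ := fun p => (Ico a b).indicator 1 p.2 * φ p
  -- The sampling times decrease to `t` strictly from the right, whence the need for right
  -- continuity at almost every time.
  have hlim : ∀ᵐ t, ∀ x, Tendsto (fun n => Φ n (x, t)) atTop (𝓝 (ψ (x, t))) := by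
    filter_upwards [ae_tendsto_right (fun t _ => hd.abs_sub_le t) hJ hd.left_continuous,
      ae_tendsto_right (fun t _ => hd'.abs_sub_le t) hJ hd'.left_continuous] with t h1 h2 x
    by_cases ht : t ∈ Ico a b
    · have htJ : t ∈ J := habJ (Ico_subset_Icc_self ht)
      have hτ : Tendsto (fun n => stepTime a (h n) t) atTop (𝓝[>] t) := by
        refine tendsto_nhdsWithin_iff.2 ⟨?_, Eventually.of_forall fun n => lt_stepTime (hh n) t⟩
        refine tendsto_of_tendsto_of_tendsto_of_le_of_le (g := fun _ => t) (h := fun n => t + h n)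
          tendsto_const_nhds ?_ (fun n => (lt_stepTime (hh n) t).le)
          (fun n => stepTime_le (hh n) ht.1)
        have : Tendsto h atTop (𝓝 0) := tendsto_const_nhds.div_atTop
          (tendsto_natCast_atTop_atTop.atTop_add tendsto_const_nhds)
        simpa using this.const_add t
      have hct : Tendsto c (𝓝[>] t) (𝓝 (c t)) := (hcc.tendsto t).mono_left nhdsWithin_le_nhds
      have hsm : ∀ {δ : ℝ → ℝ}, Tendsto δ (𝓝[>] t) (𝓝 (δ t)) →
          Tendsto (fun r => softMax ε (c r) (δ r)) (𝓝[>] t) (𝓝 (softMax ε (c t) (δ t))) :=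
        fun hδ => ((continuous_softMax hε).tendsto (c t, _)).comp (hct.prodMk_nhds hδ)
      have hφt : Tendsto (fun r => φ (x, r)) (𝓝[>] t) (𝓝 (φ (x, t))) :=
        tendsto_const_nhds.max (tendsto_const_nhds.sub ((hsm (h1 htJ x)).add (hsm (h2 htJ x))))
      exact (hφt.comp hτ).const_mul _
    · simp only [Φ, ψ, sampled, indicator_of_notMem ht, zero_mul]
      exact tendsto_const_nhds
  have hψL : IsSpatiallyLipschitz (max 2 D) R a b ψ := by
    have hind0 : ∀ t, 0 ≤ (Ico a b).indicator (1 : ℝ → ℝ) t :=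
      fun t => indicator_nonneg (fun _ _ => zero_le_one) _
    have hind1 : ∀ t, (Ico a b).indicator (1 : ℝ → ℝ) t ≤ 1 :=
      fun t => indicator_le_self' (fun _ _ => zero_le_one) _
    refine ⟨fun p => ?_, fun x y t => ?_, fun p hp => ?_⟩
    · rw [abs_mul, abs_of_nonneg (hind0 _)]
      exact (mul_le_of_le_one_left (abs_nonneg _) (hind1 _)).trans (hφb _)
    · rw [← mul_sub, abs_mul, abs_of_nonneg (hind0 _)]
      exact (mul_le_of_le_one_left (abs_nonneg _) (hind1 _)).trans (hφl _ x y)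
    · have ht := Ico_subset_Icc_self (mem_of_indicator_ne_zero (left_ne_zero_of_mul hp))
      exact ⟨hφR _ ht _ (right_ne_zero_of_mul hp), ht⟩
  have hint : ∀ {ζ : Space N × Space N × ℝ → ℝ}, IsUnitField J ζ →
      IntegrableOn (divIntegrand s ζ ψ) (fieldDomain N J) := by
    intro ζ hζ
    refine Integrable.mono' (integrable_divMajorant hN hs0 hs1 (max 2 D) R a b).integrableOn ?_
      (hζ.abs_divIntegrand_le hψL)
    -- Joint measurability of `ψ` has not been established; the integrand inherits measurability
    -- from the sampled ones.
    refine aestronglyMeasurable_of_tendsto_ae atTop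
      (fun n => hζ.aestronglyMeasurable_divIntegrand (s := s) (hΦm n)) ?_
    refine ae_restrict_of_ae ?_
    filter_upwards [ae_snd_snd hlim] with q hq
    exact (((hq q.1).sub (hq q.2.1)).div_const _).const_mul _
  have hsign : 0 ≤ fracDiv s J z ψ + fracDiv s J z' ψ := by
    rw [fracDiv_eq, fracDiv_eq, ← mul_add, ← integral_add (hint hd.field) (hint hd'.field)]
    refine mul_nonneg_of_nonpos_of_nonpos ?_ ?_
    · have := fracConst_nonneg (N := N) hs1
      linarith
    · refine integral_nonpos_of_ae ?_
      filter_upwards [hd.field.abs_le_one, hd'.field.abs_le_one, hd.calibrated, hd'.calibrated]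
        with q h1 h2 h3 h4
      obtain ⟨x, y, t⟩ := q
      have hi : 0 ≤ (Ico a b).indicator (1 : ℝ → ℝ) t :=
        indicator_nonneg (fun _ _ => zero_le_one) _
      have hk : 0 ≤ ‖x - y‖ ^ ((N : ℝ) + s) := by positivity
      have hcal := calibration_nonpos (T := φ (x, t) - φ (y, t)) h1 h2 h3 h4
        (fun e e' => sub_nonneg.2 (defect_anti hε c e e'))
        (fun e e' => sub_nonpos.2 (defect_anti hε c e e'))
      simp only [divIntegrand, ψ, Pi.zero_apply]
      have e : z (x, y, t) * (((Ico a b).indicator 1 t * φ (x, t) -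
          (Ico a b).indicator 1 t * φ (y, t)) / ‖x - y‖ ^ ((N : ℝ) + s)) +
          z' (x, y, t) * (((Ico a b).indicator 1 t * φ (x, t) -
          (Ico a b).indicator 1 t * φ (y, t)) / ‖x - y‖ ^ ((N : ℝ) + s)) =
          ((Ico a b).indicator 1 t / ‖x - y‖ ^ ((N : ℝ) + s)) *
          (z (x, y, t) * (φ (x, t) - φ (y, t)) + z' (x, y, t) * (φ (x, t) - φ (y, t))) := by
        ring
      rw [e]
      exact mul_nonpos_of_nonneg_of_nonpos (div_nonneg hi hk) hcal
  have hfin := ge_of_tendsto' (((tendsto_fracDiv hN hs0 hs1 hd.field hΦm hΦL hlim).add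
    (tendsto_fracDiv hN hs0 hs1 hd'.field hΦm hΦL hlim)).const_mul (-2)) hΦle
  linarith

/-! ### Calibrating fields give local supersolutions -/

lemma IsTestFunction.mono {Ω Ω' : Set (Space N × ℝ)} {φ : Space N × ℝ → ℝ}
    (h : IsTestFunction Ω φ) (hΩ : Ω ⊆ Ω') : IsTestFunction Ω' φ :=
  ⟨h.1, h.2.1, h.2.2.trans hΩ⟩

lemma deriv_time_eq_zero {φ : Space N × ℝ → ℝ} {p : Space N × ℝ} (hp : p ∉ tsupport φ) :
    deriv (fun τ => φ (p.1, τ)) p.2 = 0 := by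
  have h := notMem_tsupport_iff_eventuallyEq.1 hp
  have hc : Tendsto (fun τ => (p.1, τ)) (𝓝 p.2) (𝓝 p) :=
    Continuous.tendsto (by fun_prop) p.2
  have : (fun τ => φ (p.1, τ)) =ᶠ[𝓝 p.2] fun _ => 0 := hc.eventually h
  rw [this.deriv_eq]; simp

/-- Integration by parts in the direction `(0, 1)`. It converts an upper bound `C` on the divergence
into the statement that `C t` is a supersolution. -/
lemma IsTestFunction.neg_integral_time {Ω : Set (Space N × ℝ)} {φ : Space N × ℝ → ℝ}
    (h : IsTestFunction Ω φ) (C : ℝ) :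
    -∫ p : Space N × ℝ, C * p.2 * deriv (fun τ => φ (p.1, τ)) p.2 = C * ∫ p, φ p := by
  have hdiff : Differentiable ℝ φ := h.1.differentiable (by simp)
  let v : Space N × ℝ := (0, 1)
  have hderiv : ∀ p : Space N × ℝ, deriv (fun τ => φ (p.1, τ)) p.2 = fderiv ℝ φ p v := fun p => by
    have h1 : HasDerivAt (fun τ : ℝ => (p.1, τ)) v p.2 :=
      (hasDerivAt_const p.2 p.1).prodMk (hasDerivAt_id p.2)
    exact ((hdiff p).hasFDerivAt.comp_hasDerivAt p.2 h1).deriv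
  have hcf : Continuous fun p => fderiv ℝ φ p v :=
    (h.1.continuous_fderiv (by simp)).clm_apply continuous_const
  have hcs : HasCompactSupport fun p => fderiv ℝ φ p v := h.2.1.fderiv_apply (𝕜 := ℝ) v
  have hf : ∀ p : Space N × ℝ, HasFDerivAt (fun p : Space N × ℝ => C * p.2)
      (C • ContinuousLinearMap.snd ℝ (Space N) ℝ) p := fun p =>
    (ContinuousLinearMap.snd ℝ (Space N) ℝ).hasFDerivAt.const_mul C
  have hfv : ∀ p : Space N × ℝ, fderiv ℝ (fun p : Space N × ℝ => C * p.2) p v = C := fun p => by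
    rw [(hf p).fderiv]; simp [v]
  have hlin : Continuous fun p : Space N × ℝ => C * p.2 := by fun_prop
  have : (volume : Measure (Space N × ℝ)).IsAddHaarMeasure :=
    inferInstanceAs ((volume : Measure (Space N)).prod (volume : Measure ℝ)).IsAddHaarMeasure
  have key := integral_mul_fderiv_eq_neg_fderiv_mul_of_integrable
    (μ := (volume : Measure (Space N × ℝ))) (f := fun p : Space N × ℝ => C * p.2) (g := φ) (v := v)
    (by simp only [hfv]
        exact (continuous_const.mul h.1.continuous).integrable_of_hasCompactSupport h.2.1.mul_left)
    ((hlin.mul hcf).integrable_of_hasCompactSupport hcs.mul_left)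
    ((hlin.mul h.1.continuous).integrable_of_hasCompactSupport h.2.1.mul_left)
    (fun p _ => (hf p).differentiableAt) (fun p _ => hdiff p)
  simp only [hderiv]
  rw [key, neg_neg]
  simp only [hfv]
  rw [integral_const_mul]

lemma measurableSet_lifespan (E : Set (Space N × ℝ)) : MeasurableSet (lifespan E) :=
  measurableSet_Ioi.inter (measurable_coe_real_ereal measurableSet_Iio)

lemma fracDiv_lifespan_eq {E : Set (Space N × ℝ)} {J : Set ℝ} (hJ : J ⊆ lifespan E)
    {U : Set (Space N)} {φ : Space N × ℝ → ℝ} (hφ : IsTestFunction (U ×ˢ J) φ)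
    (z : Space N × Space N × ℝ → ℝ) : fracDiv s (lifespan E) z φ = fracDiv s J z φ :=
  fracDiv_eq_of_subset hJ (measurableSet_lifespan E) z
    fun _ hp => (hφ.2.2 (subset_tsupport φ hp)).2

/-- A bound for the positive part of the divergence, away from the set. -/
lemma IsCalibratingField.exists_fracDiv_le {E : Set (Space N × ℝ)}
    {z : Space N × Space N × ℝ → ℝ} (hz : IsCalibratingField s E z) {l : ℝ} (hl : 0 < l) :
    ∃ C : ℝ, 0 ≤ C ∧ ∀ φ : Space N × ℝ → ℝ,
      IsTestFunction (outerRegion E) φ → (∀ p, 0 ≤ φ p) →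
      tsupport φ ⊆ {p | p.2 ∈ lifespan E ∧ l ≤ distFun E p} →
      fracDiv s (lifespan E) z φ ≤ C * ∫ p, φ p := by
  obtain ⟨P, M, ⟨hfin, -, hT⟩, hP⟩ := hz.posPart_bounded
  obtain ⟨g, hg, hPg, hess⟩ := hP l hl
  set S := {p : Space N × ℝ | p.2 ∈ lifespan E ∧ l ≤ distFun E p} with hS
  refine ⟨(essSup g (volume.restrict S)).toReal, ENNReal.toReal_nonneg, fun φ hφ h0 hφS => ?_⟩
  set C := essSup g (volume.restrict S) with hC
  have hint : Integrable φ := hφ.1.continuous.integrable_of_hasCompactSupport hφ.2.1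
  -- On `S` the positive part has density at most its essential supremum; the negative part `M` only
  -- lowers the divergence and is dropped.
  have hle : P.restrict S ≤ C • volume.restrict S := by
    rw [hPg, ← withDensity_const]
    exact withDensity_mono (ENNReal.ae_le_essSup g)
  have h1 : ∫ p, φ p ∂P = ∫ p, φ p ∂(P.restrict S) :=
    (setIntegral_eq_integral_of_forall_compl_eq_zero fun p hp => by
      by_contra h
      exact hp (hφS (subset_tsupport φ h))).symm
  have h2 : ∫ p, φ p ∂(P.restrict S) ≤ ∫ p, φ p ∂(C • volume.restrict S) :=
    integral_mono_measure hle (Eventually.of_forall h0)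
      (hint.restrict.smul_measure hess.ne)
  have h3 : ∫ p, φ p ∂(C • volume.restrict S) = C.toReal * ∫ p in S, φ p := by
    rw [integral_smul_measure, smul_eq_mul]
  have h4 : ∫ p in S, φ p ≤ ∫ p, φ p := setIntegral_le_integral hint (Eventually.of_forall h0)
  have h5 : 0 ≤ ∫ p, φ p ∂M := integral_nonneg h0
  rw [hT φ hφ]
  have h6 := mul_le_mul_of_nonneg_left h4 (ENNReal.toReal_nonneg (a := C))
  linarith

lemma IsCalibratingField.isUnitField {E : Set (Space N × ℝ)}
    {z : Space N × Space N × ℝ → ℝ} (hz : IsCalibratingField s E z) :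
    IsUnitField (lifespan E) z := by
  refine ⟨hz.measurable, ?_⟩
  have h := hz.norm_le_one
  rw [eLpNorm_exponent_top] at h
  filter_upwards [ae_le_eLpNormEssSup (f := z) (μ := volume.restrict (fieldDomain N (lifespan E)))]
    with q hq
  have := hq.trans h
  rw [← ofReal_norm, ENNReal.ofReal_le_one] at this
  exact this

lemma distFun_pos_subset {E : Set (Space N × ℝ)} {p : Space N × ℝ} (hp : p.2 ∈ lifespan E)
    (hd : 0 < distFun E p) : p ∈ outerRegion E :=
  ⟨hp, fun hE => hd.ne' (Metric.infDist_zero_of_mem hE)⟩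

/-- On the cylinder the distance is at least `l > 0`. So the cylinder lies in the outer region,
where the equation holds, and in the set where the divergence is bounded above. -/
lemma IsCalibratingField.isLocalSupersolution {E : Set (Space N × ℝ)}
    {z : Space N × Space N × ℝ → ℝ} (hz : IsCalibratingField s E z) {l C : ℝ} (hl : 0 < l)
    (hC : ∀ φ : Space N × ℝ → ℝ, IsTestFunction (outerRegion E) φ → (∀ p, 0 ≤ φ p) →
      tsupport φ ⊆ {p | p.2 ∈ lifespan E ∧ l ≤ distFun E p} →
      fracDiv s (lifespan E) z φ ≤ C * ∫ p, φ p)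
    {J : Set ℝ} (hJ : J ⊆ lifespan E) {U : Set (Space N)}
    (hU : ∀ x ∈ U, ∀ t ∈ J, l ≤ distFun E (x, t))
    (hleft : ∀ t ∈ J, ∀ x, Tendsto (fun r => distFun E (x, r)) (𝓝[<] t) (𝓝 (distFun E (x, t)))) :
    IsLocalSupersolution s C U J (distFun E) z := by
  have hsub : U ×ˢ J ⊆ {p | p.2 ∈ lifespan E ∧ l ≤ distFun E p} := fun p hp =>
    ⟨hJ hp.2, hU p.1 hp.1 p.2 hp.2⟩
  have hsub' : U ×ˢ J ⊆ outerRegion E := fun p hp =>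
    distFun_pos_subset (hJ hp.2) (hl.trans_le (hU p.1 hp.1 p.2 hp.2))
  refine ⟨hz.isUnitField.mono hJ, hz.supersolution.1.mono_set hsub',
    fun p => Metric.infDist_nonneg, fun t x y => ?_, hleft, fun φ hφ h0 => ?_, fun φ hφ h0 => ?_, ?_⟩
  · have := (Metric.lipschitz_infDist_pt (slice E t)).dist_le_mul x y
    rw [Real.dist_eq, dist_eq_norm, NNReal.coe_one, one_mul] at this
    exact this
  · have h := hz.supersolution.2 φ (hφ.mono hsub') h0
    rw [fracDiv_lifespan_eq hJ hφ] at h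
    refine h.trans_eq (congrArg Neg.neg ?_)
    refine setIntegral_eq_integral_of_forall_compl_eq_zero fun p hp => ?_
    rw [deriv_time_eq_zero fun h => hp (hsub' (hφ.2.2 h)), mul_zero]
  · rw [hφ.neg_integral_time, ← fracDiv_lifespan_eq hJ hφ]
    exact hC φ (hφ.mono hsub') h0 (hφ.2.2.trans hsub)
  · exact ae_restrict_of_ae_restrict_of_subset
      (show fieldDomain N J ⊆ fieldDomain N (lifespan E) from fun _ hq => hJ hq) hz.cahnHoffman

/-! ### Slices of superflows -/

/-- Induction forward in time. -/
lemma forall_ge_of_local {P : ℝ → Prop} {a : ℝ} (ha : P a)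
    (hright : ∀ t, a ≤ t → P t → ∃ τ : ℝ, 0 < τ ∧ ∀ r ∈ Ioo t (t + τ), P r)
    (hleft : ∀ t, a < t → (∀ r ∈ Ico a t, P r) → P t) : ∀ t, a ≤ t → P t := by
  by_contra! hcon
  obtain ⟨b, hab, hb⟩ := hcon
  let B : Set ℝ := {t | a ≤ t ∧ ¬ P t}
  have hne : B.Nonempty := ⟨b, hab, hb⟩
  have hbdd : BddBelow B := ⟨a, fun t ht => ht.1⟩
  have hat : a ≤ sInf B := le_csInf hne fun t ht => ht.1
  have hlt : ∀ r ∈ Ico a (sInf B), P r := fun r hr => by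
    by_contra h
    exact absurd (csInf_le hbdd ⟨hr.1, h⟩) (not_le.2 hr.2)
  have hP : P (sInf B) := by
    rcases hat.eq_or_lt with h | h
    · rwa [← h]
    · exact hleft _ h hlt
  obtain ⟨τ, hτ, hr⟩ := hright _ hat hP
  obtain ⟨t, ht, htlt⟩ := exists_lt_of_csInf_lt hne (show sInf B < sInf B + τ by linarith)
  rcases (csInf_le hbdd ht).eq_or_lt with h | h
  · exact ht.2 (h ▸ hP)
  · exact ht.2 (hr t ⟨h, htlt⟩)

/-- Almost nearest points that remain in a fixed ball cluster at a point of `L`, which gives the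
lower bound; a sequence converging to an almost nearest point of `L` gives the upper one. -/
lemma KuratowskiTendsto.tendsto_infDist {X : Type*} [PseudoMetricSpace X] [ProperSpace X]
    {D : ℕ → Set X} {L : Set X} (h : KuratowskiTendsto D L) (hD : ∀ n, (D n).Nonempty)
    (hL : L.Nonempty) (x : X) :
    Tendsto (fun n => Metric.infDist x (D n)) atTop (𝓝 (Metric.infDist x L)) := by
  rw [tendsto_order]
  constructor
  · intro c hc
    by_contra hcon
    have hfreq : ∃ᶠ n in atTop, Metric.infDist x (D n) ≤ c := by
      rw [Filter.not_eventually] at hcon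
      exact hcon.mono fun n hn => not_lt.1 hn
    obtain ⟨c', hcc', hc'⟩ := exists_between hc
    -- Kuratowski convergence speaks of sequences with a term in every `D n`, so at the indices
    -- outside the frequent set an arbitrary point is chosen.
    have hch : ∀ n, ∃ y ∈ D n, Metric.infDist x (D n) ≤ c → dist x y < c' := fun n => by
      by_cases hn : Metric.infDist x (D n) ≤ c
      · obtain ⟨y, hy, hyd⟩ := (Metric.infDist_lt_iff (hD n)).1 (hn.trans_lt hcc')
        exact ⟨y, hy, fun _ => hyd⟩
      · obtain ⟨y, hy⟩ := hD n
        exact ⟨y, hy, fun h => absurd h hn⟩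
    choose y hyD hyd using hch
    obtain ⟨a, ha, hcl⟩ := (isCompact_closedBall x c').exists_mapClusterPt_of_frequently
      (f := y) (hfreq.mono fun n hn => by
        rw [Metric.mem_closedBall, dist_comm]; exact (hyd n hn).le)
    have haL := h.1 y hyD a hcl
    have h1 := Metric.infDist_le_dist_of_mem (x := x) haL
    rw [Metric.mem_closedBall, dist_comm] at ha
    linarith
  · intro c hc
    obtain ⟨a, haL, hac⟩ := (Metric.infDist_lt_iff hL).1 hc
    obtain ⟨y, hyD, hy⟩ := h.2 a haL
    filter_upwards [(tendsto_const_nhds.dist hy).eventually_lt_const hac] with n hn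
    exact (Metric.infDist_le_dist_of_mem (hyD n)).trans_lt hn

/-- A sequence of earlier times converging to `t`. -/
lemma exists_seq_tendsto_left {a t : ℝ} (hat : a < t) :
    ∃ r : ℕ → ℝ, (∀ n, r n ∈ Ico a t) ∧ Tendsto r atTop (𝓝 t) := by
  refine ⟨fun n => t - (t - a) / (n + 1), fun n => ⟨?_, ?_⟩, ?_⟩
  · have : (t - a) / ((n : ℝ) + 1) ≤ t - a :=
      div_le_self (by linarith) (by linarith [Nat.cast_nonneg (α := ℝ) n])
    linarith
  · have : 0 < (t - a) / ((n : ℝ) + 1) := div_pos (by linarith) (by positivity)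
    linarith
  · have : Tendsto (fun n : ℕ => (t - a) / ((n : ℝ) + 1)) atTop (𝓝 0) :=
      tendsto_const_nhds.div_atTop (tendsto_natCast_atTop_atTop.atTop_add tendsto_const_nhds)
    simpa using this.const_sub t

/-- A neighbourhood of the empty set is empty, and so is a Kuratowski limit of empty sets.
Nonemptiness thus passes to earlier times, which matters since `Metric.infDist` to the empty set is
`0`. -/
lemma IsWeakSuperflow.slice_eq_empty {E : Set (Space N × ℝ)} {E0 : Set (Space N)}
    (hE : IsWeakSuperflow s E E0) {t₀ : ℝ} (ht₀ : 0 ≤ t₀) (h : slice E t₀ = ∅) :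
    ∀ t, t₀ ≤ t → slice E t = ∅ := by
  refine forall_ge_of_local h (fun t ht hP => ?_) (fun t ht hP => ?_)
  · obtain ⟨τ, hτ, hr⟩ := hE.right_semicontinuous t (ht₀.trans ht) 1 one_pos
    refine ⟨τ, hτ, fun r hrr => ?_⟩
    have := hr r hrr
    rw [hP, Metric.thickening_empty] at this
    exact subset_empty_iff.1 this
  · obtain ⟨r, hr, hlim⟩ := exists_seq_tendsto_left ht
    have hK := hE.left_continuous t (ht₀.trans_lt ht) r
      (fun n => ⟨ht₀.trans (hr n).1, (hr n).2⟩) hlim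
    refine eq_empty_of_forall_notMem fun a ha => ?_
    obtain ⟨x, hx, -⟩ := hK.2 a ha
    have hx0 : x 0 ∈ slice E (r 0) := hx 0
    rw [hP _ (hr 0)] at hx0
    exact hx0

lemma IsWeakSuperflow.slice_nonempty {E : Set (Space N × ℝ)} {E0 : Set (Space N)}
    (hE : IsWeakSuperflow s E E0) {t t₁ : ℝ} (ht : 0 ≤ t) (htt : t ≤ t₁)
    (h : (slice E t₁).Nonempty) : (slice E t).Nonempty := by
  rw [nonempty_iff_ne_empty] at *
  exact fun he => h (hE.slice_eq_empty ht he t₁ htt)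

lemma Ioo_subset_lifespan {E : Set (Space N × ℝ)} {t₀ t₁ : ℝ} (ht₀ : 0 ≤ t₀)
    (h : (slice E t₁).Nonempty) : Ioo t₀ t₁ ⊆ lifespan E := fun t ht => by
  refine ⟨ht₀.trans_lt ht.1, lt_of_lt_of_le (EReal.coe_lt_coe_iff.2 ht.2) (le_sInf ?_)⟩
  rintro T ⟨r, rfl, -, hr⟩
  rw [EReal.coe_le_coe_iff]
  by_contra hlt
  exact h.ne_empty (hr t₁ (not_le.1 hlt).le)

lemma IsWeakSuperflow.tendsto_distFun {E : Set (Space N × ℝ)} {E0 : Set (Space N)}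
    (hE : IsWeakSuperflow s E E0) {t : ℝ} (ht : 0 < t) (h : (slice E t).Nonempty) (x : Space N) :
    Tendsto (fun r => distFun E (x, r)) (𝓝[<] t) (𝓝 (distFun E (x, t))) := by
  refine tendsto_of_seq_tendsto fun r hr => ?_
  have hr' := tendsto_nhdsWithin_iff.1 hr
  have hev : ∀ᶠ n in atTop, 0 ≤ r n ∧ r n < t :=
    (hr'.1.eventually_const_le ht).and hr'.2
  obtain ⟨n₀, hn₀⟩ := eventually_atTop.1 hev
  rw [← tendsto_add_atTop_iff_nat n₀]
  have hK := hE.left_continuous t ht (fun n => r (n + n₀)) (fun n => hn₀ _ (by omega))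
    ((tendsto_add_atTop_iff_nat n₀).2 hr'.1)
  exact hK.tendsto_infDist (fun n => hE.slice_nonempty (hn₀ _ (by omega)).1
    (hn₀ (n + n₀) (by omega)).2.le h) h x

lemma infDist_sub_le_of_subset_thickening {A B : Set (Space N)} {δ : ℝ}
    (h : B ⊆ Metric.thickening δ A) (hB : B.Nonempty) (x : Space N) :
    Metric.infDist x A - δ ≤ Metric.infDist x B := by
  rw [Metric.le_infDist hB]
  intro y hy
  obtain ⟨w, hw, hyw⟩ := Metric.mem_thickening_iff.1 (h hy)
  have h1 := Metric.infDist_le_dist_of_mem (x := x) hw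
  have h2 := dist_triangle x y w
  linarith

lemma le_infDist_add_infDist {A B : Set (Space N)} {D : ℝ} (hA : A.Nonempty) (hB : B.Nonempty)
    (h : ∀ x ∈ A, ∀ y ∈ B, D ≤ dist x y) (x : Space N) :
    D ≤ Metric.infDist x A + Metric.infDist x B := by
  rw [← sub_le_iff_le_add, Metric.le_infDist hA]
  intro w hw
  rw [sub_le_comm, Metric.le_infDist hB]
  intro y hy
  have h1 := h w hw y hy
  have h2 := dist_triangle_left w y x
  linarith

/-! ### The comparison principle -/

/-- A defect which vanishes initially vanishes at all times. -/
lemma defect_eq_zero (hN : 1 ≤ N) (hs0 : 0 < s) (hs1 : s < 1) {C : ℝ}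
    {U : Set (Space N)} (hU : IsOpen U) {t₀ T : ℝ} {d d' : Space N × ℝ → ℝ}
    {z z' : Space N × Space N × ℝ → ℝ} (hd : IsLocalSupersolution s C U (Ioo t₀ T) d z)
    (hd' : IsLocalSupersolution s C U (Ioo t₀ T) d' z') {D ε : ℝ} (hD : 0 ≤ D) (hε : 0 < ε)
    {c : ℝ → ℝ} (hcc : Continuous c) (hc : ∀ t₁ t₂, c t₂ - c t₁ = C * (t₂ - t₁))
    {K : Set (Space N)} (hK : IsCompact K) (hKU : K ⊆ U)
    (hsupp : ∀ t ∈ Ioo t₀ T, ∀ x, defect D ε c d d' (x, t) ≠ 0 → x ∈ K)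
    (hinit : ∀ η, 0 < η → ∀ b ∈ Ioo t₀ T, ∃ a, t₀ < a ∧ a < b ∧
      ∀ x, defect D ε c d d' (x, a) ≤ η) :
    ∀ b ∈ Ioo t₀ T, ∀ x, defect D ε c d d' (x, b) = 0 := by
  set φ := defect D ε c d d' with hφ
  have hφ0 : ∀ p, 0 ≤ φ p := defect_nonneg _ _ _ _ _
  have hφcont : ∀ t, Continuous fun x => φ (x, t) := fun t =>
    continuous_of_abs_sub_le zero_le_two
      (abs_defect_sub_le hε c (hd.abs_sub_le t) (hd'.abs_sub_le t))
  have hφK : ∀ t ∈ Ioo t₀ T, ∀ x ∉ K, φ (x, t) ^ 2 = 0 := fun t ht x hx => by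
    have : φ (x, t) = 0 := by_contra fun h => hx (hsupp t ht x h)
    simp [this]
  intro b hb x
  -- At some earlier time `a` the defect is at most `η` and supported in `K`; its `L²` norm does not
  -- increase up to `b`.
  have hbound : ∀ η : ℝ, 0 < η → ∫ x, φ (x, b) ^ 2 ≤ η ^ 2 * volume.real K := by
    intro η hη
    obtain ⟨a, ha1, hab, hpt⟩ := hinit η hη b hb
    have haJ : a ∈ Ioo t₀ T := ⟨ha1, hab.trans hb.2⟩
    refine (integral_sq_defect_le hN hs0 hs1 hU isOpen_Ioo hd hd' hD hε hcc hc hK hKU hsupp hab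
      (fun t ht => ⟨ha1.trans_le ht.1, ht.2.trans_lt hb.2⟩)).trans ?_
    rw [← setIntegral_eq_integral_of_forall_compl_eq_zero (hφK a haJ)]
    calc ∫ x in K, φ (x, a) ^ 2 ≤ ∫ _ in K, η ^ 2 :=
          setIntegral_mono (((hφcont a).pow 2).continuousOn.integrableOn_compact hK)
            (integrableOn_const hK.measure_lt_top.ne)
            fun x => pow_le_pow_left₀ (hφ0 _) (hpt x) 2
      _ = η ^ 2 * volume.real K := by rw [setIntegral_const, smul_eq_mul, mul_comm]
  have hlim : Tendsto (fun η : ℝ => η ^ 2 * volume.real K) (𝓝[>] 0) (𝓝 0) := by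
    have : Tendsto (fun η : ℝ => η ^ 2 * volume.real K) (𝓝 0)
        (𝓝 (0 ^ 2 * volume.real K)) := Continuous.tendsto (by fun_prop) 0
    simpa using this.mono_left nhdsWithin_le_nhds
  have hle : ∫ x, φ (x, b) ^ 2 ≤ 0 :=
    ge_of_tendsto hlim (by filter_upwards [self_mem_nhdsWithin] with η hη using hbound η hη)
  by_contra hx
  exact absurd hle (not_le.2 (((hφcont b).pow 2).integral_pos_of_hasCompactSupport_nonneg_nonzero
    (HasCompactSupport.intro hK (hφK b hb)) (fun y => sq_nonneg _) (x := x) (pow_ne_zero 2 hx)))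

/-- The core step. Boundedness of one slice makes the support of the defect compact, and a common
time `t₁` of nonempty slices places the interval within both lifespans. -/
lemma separation_right_of_bounded (hN : 1 ≤ N) (hs0 : 0 < s) (hs1 : s < 1)
    {E G : Set (Space N × ℝ)} {E0 G0 : Set (Space N)} (hE : IsWeakSuperflow s E E0)
    (hG : IsWeakSuperflow s G G0) {D : ℝ} (hD : 0 < D) {t₀ t₁ : ℝ} (ht₀ : 0 ≤ t₀) (ht₁ : t₀ < t₁)
    (hEt₁ : (slice E t₁).Nonempty) (hGt₁ : (slice G t₁).Nonempty)
    (hbdd : Bornology.IsBounded (slice E t₀))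
    (h : ∀ x ∈ slice E t₀, ∀ y ∈ slice G t₀, D ≤ dist x y) :
    ∃ τ : ℝ, 0 < τ ∧ ∀ r ∈ Ioo t₀ (t₀ + τ), ∀ x ∈ slice E r, ∀ y ∈ slice G r, D ≤ dist x y := by
  obtain ⟨z, hz⟩ := hE.exists_field
  obtain ⟨z', hz'⟩ := hG.exists_field
  -- The midpoint argument at the end needs the truncation level plus the smoothing error, `4δ + C τ
  -- + δ`, to stay below `D / 2 = 8δ`.
  obtain ⟨δ, hδ⟩ : ∃ δ, δ = D / 16 := ⟨_, rfl⟩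
  have hδ0 : 0 < δ := by rw [hδ]; positivity
  obtain ⟨C₁, hC₁0, hC₁⟩ := hz.exists_fracDiv_le hδ0
  obtain ⟨C₂, hC₂0, hC₂⟩ := hz'.exists_fracDiv_le hδ0
  obtain ⟨C, hCdef⟩ : ∃ C, C = max C₁ C₂ := ⟨_, rfl⟩
  have hC0 : 0 ≤ C := hCdef ▸ hC₁0.trans (le_max_left _ _)
  -- lower bounds for the distances just after the initial time
  have hlow : ∀ η, 0 < η → ∃ τ, 0 < τ ∧ ∀ r ∈ Ioo t₀ (t₀ + τ), r < t₁ → ∀ x,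
      distFun E (x, t₀) - η ≤ distFun E (x, r) ∧ distFun G (x, t₀) - η ≤ distFun G (x, r) := by
    intro η hη
    obtain ⟨τ, hτ, h1⟩ := hE.right_semicontinuous t₀ ht₀ η hη
    obtain ⟨τ', hτ', h2⟩ := hG.right_semicontinuous t₀ ht₀ η hη
    refine ⟨min τ τ', lt_min hτ hτ', fun r hr hrt x => ⟨?_, ?_⟩⟩
    · exact infDist_sub_le_of_subset_thickening
        (h1 r ⟨hr.1, hr.2.trans_le (by linarith [min_le_left τ τ'])⟩)
        (hE.slice_nonempty (ht₀.trans hr.1.le) hrt.le hEt₁) x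
    · exact infDist_sub_le_of_subset_thickening
        (h2 r ⟨hr.1, hr.2.trans_le (by linarith [min_le_right τ τ'])⟩)
        (hG.slice_nonempty (ht₀.trans hr.1.le) hrt.le hGt₁) x
  obtain ⟨τ₀, hτ₀, hlow₀⟩ := hlow δ hδ0
  -- The last bound forces `C τ < 3δ`, the room left between `5δ` and `8δ`.
  obtain ⟨τ, hτ⟩ : ∃ τ, τ = min (min τ₀ (t₁ - t₀)) (3 * δ / (C + 1)) := ⟨_, rfl⟩
  have hτpos : 0 < τ := by
    rw [hτ]; exact lt_min (lt_min hτ₀ (by linarith)) (by positivity)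
  have hτ1 : τ ≤ τ₀ := hτ ▸ (min_le_left _ _).trans (min_le_left _ _)
  have hτ2 : τ ≤ t₁ - t₀ := hτ ▸ (min_le_left _ _).trans (min_le_right _ _)
  have hτ3 : (C + 1) * τ ≤ 3 * δ := by
    have : τ ≤ 3 * δ / (C + 1) := hτ ▸ min_le_right _ _
    rw [le_div_iff₀ (by positivity)] at this
    linarith
  have hE₀ : (slice E t₀).Nonempty := hE.slice_nonempty ht₀ ht₁.le hEt₁
  have hG₀ : (slice G t₀).Nonempty := hG.slice_nonempty ht₀ ht₁.le hGt₁
  set J := Ioo t₀ (t₀ + τ) with hJ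
  have hJt₁ : ∀ r ∈ J, r < t₁ := fun r hr => by linarith [hr.2]
  have hJτ : ∀ r ∈ J, r ∈ Ioo t₀ (t₀ + τ₀) := fun r hr => ⟨hr.1, by linarith [hr.2]⟩
  have hJ0 : ∀ r ∈ J, 0 < r := fun r hr => ht₀.trans_lt hr.1
  have hlow' : ∀ r ∈ J, ∀ x, distFun E (x, t₀) - δ ≤ distFun E (x, r) ∧
      distFun G (x, t₀) - δ ≤ distFun G (x, r) := fun r hr => hlow₀ r (hJτ r hr) (hJt₁ r hr)
  have hEr : ∀ r ∈ J, (slice E r).Nonempty := fun r hr =>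
    hE.slice_nonempty (hJ0 r hr).le (hJt₁ r hr).le hEt₁
  have hGr : ∀ r ∈ J, (slice G r).Nonempty := fun r hr =>
    hG.slice_nonempty (hJ0 r hr).le (hJt₁ r hr).le hGt₁
  have hJE : J ⊆ lifespan E := (Ioo_subset_Ioo_right (by linarith)).trans
    (Ioo_subset_lifespan ht₀ hEt₁)
  have hJG : J ⊆ lifespan G := (Ioo_subset_Ioo_right (by linarith)).trans
    (Ioo_subset_lifespan ht₀ hGt₁)
  have hcont : ∀ A : Set (Space N × ℝ), Continuous fun x => distFun A (x, t₀) := fun A => by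
    simp only [distFun]
    exact Metric.continuous_infDist_pt (slice A t₀)
  have hsum : ∀ x, D ≤ distFun E (x, t₀) + distFun G (x, t₀) := by
    simp only [distFun]
    exact le_infDist_add_infDist hE₀ hG₀ h
  -- A cascade of margins: truncation starts at `4δ`, so the defect lives where both initial
  -- distances are at least `3δ`. This set `K` lies in the open set `U` given by `2δ`, on which the
  -- distances stay above `δ` during `J`.
  let U : Set (Space N) := {x | 2 * δ < distFun E (x, t₀) ∧ 2 * δ < distFun G (x, t₀)}
  have hU : IsOpen U := (isOpen_lt continuous_const (hcont E)).inter
    (isOpen_lt continuous_const (hcont G))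
  let K : Set (Space N) := {x | 3 * δ ≤ distFun E (x, t₀) ∧ 3 * δ ≤ distFun G (x, t₀) ∧
    distFun E (x, t₀) ≤ D + δ}
  have hK : IsCompact K := by
    have hclosed : IsClosed K := by
      simp only [K, ofPred_and]
      exact (isClosed_le continuous_const (hcont E)).inter
        ((isClosed_le continuous_const (hcont G)).inter (isClosed_le (hcont E) continuous_const))
    refine Metric.isCompact_of_isClosed_isBounded hclosed
      ((hbdd.thickening (δ := D + 2 * δ)).subset fun x hx => ?_)
    rw [Metric.mem_thickening_iff]
    exact (Metric.infDist_lt_iff hE₀).1 (lt_of_le_of_lt hx.2.2 (by linarith))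
  have hKU : K ⊆ U := fun x hx => ⟨by linarith [hx.1], by linarith [hx.2.1]⟩
  have hdE : IsLocalSupersolution s C U J (distFun E) z := by
    refine hz.isLocalSupersolution hδ0 (fun φ h1 h2 h3 => (hC₁ φ h1 h2 h3).trans ?_) hJE
      (fun x hx t ht => by linarith [(hlow' t ht x).1, hx.1])
      (fun t ht x => hE.tendsto_distFun (hJ0 t ht) (hEr t ht) x)
    exact mul_le_mul_of_nonneg_right (hCdef ▸ le_max_left _ _) (integral_nonneg h2)
  have hdG : IsLocalSupersolution s C U J (distFun G) z' := by
    refine hz'.isLocalSupersolution hδ0 (fun φ h1 h2 h3 => (hC₂ φ h1 h2 h3).trans ?_) hJG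
      (fun x hx t ht => by linarith [(hlow' t ht x).2, hx.2])
      (fun t ht x => hG.tendsto_distFun (hJ0 t ht) (hGr t ht) x)
    exact mul_le_mul_of_nonneg_right (hCdef ▸ le_max_right _ _) (integral_nonneg h2)
  let c : ℝ → ℝ := fun t => 4 * δ + C * (t - t₀)
  have hc4 : ∀ t ∈ J, 4 * δ ≤ c t := fun t ht =>
    le_add_of_nonneg_right (mul_nonneg hC0 (by linarith [ht.1]))
  set φ := defect D δ c (distFun E) (distFun G) with hφ
  have hsupp : ∀ t ∈ J, ∀ x, φ (x, t) ≠ 0 → x ∈ K := by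
    intro t ht x hx
    -- A positive defect and `c ≥ 4δ` leave each distance below `D - 4δ`, hence below `D - 3δ` at
    -- time `t₀`; as the two distances sum to at least `D` there, both exceed `3δ`.
    have hpos : 0 < D - (softMax δ (c t) (distFun E (x, t)) + softMax δ (c t) (distFun G (x, t))) := by
      by_contra hle
      exact hx (max_eq_left (not_lt.1 hle))
    have e1 := le_softMax_left hδ0 (c t) (distFun E (x, t))
    have e2 := le_softMax_left hδ0 (c t) (distFun G (x, t))
    have e3 := le_softMax_right hδ0 (c t) (distFun E (x, t))
    have e4 := le_softMax_right hδ0 (c t) (distFun G (x, t))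
    have e5 := hlow' t ht x
    have e6 := hc4 t ht
    have e7 := hsum x
    refine ⟨?_, ?_, ?_⟩ <;> linarith [e5.1, e5.2]
  have hzero : ∀ b ∈ J, ∀ x, φ (x, b) = 0 := by
    refine defect_eq_zero hN hs0 hs1 hU hdE hdG hD.le hδ0 (c := c) (by fun_prop)
      (fun t₁ t₂ => by simp only [c]; ring) hK hKU hsupp fun η hη b hb => ?_
    obtain ⟨τ', hτ', hl⟩ := hlow (η / 2) (by positivity)
    obtain ⟨a, ha1, ha2⟩ := exists_between (show t₀ < min b (t₀ + τ') from
      lt_min hb.1 (by linarith))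
    have hab : a < b := ha2.trans_le (min_le_left _ _)
    refine ⟨a, ha1, hab, fun x => max_le hη.le ?_⟩
    have e1 := le_softMax_right hδ0 (c a) (distFun E (x, a))
    have e2 := le_softMax_right hδ0 (c a) (distFun G (x, a))
    have e3 := hl a ⟨ha1, ha2.trans_le (min_le_right _ _)⟩ (hJt₁ a ⟨ha1, hab.trans hb.2⟩) x
    have e4 := hsum x
    simp only
    linarith [e3.1, e3.2]
  refine ⟨τ, hτpos, fun b hb x hx y hy => ?_⟩
  by_contra hlt
  push Not at hlt
  -- Both truncated distances are below `8δ` at the midpoint, so their sum is below `D` and the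
  -- defect would be positive.
  let m := midpoint ℝ x y
  have hm1 : distFun E (m, b) < 8 * δ := by
    have h1 := Metric.infDist_le_dist_of_mem (x := m) hx
    rw [dist_midpoint_left] at h1
    refine lt_of_le_of_lt h1 ?_
    rw [Real.norm_ofNat]; linarith
  have hm2 : distFun G (m, b) < 8 * δ := by
    have h1 := Metric.infDist_le_dist_of_mem (x := m) hy
    rw [dist_midpoint_right] at h1
    refine lt_of_le_of_lt h1 ?_
    rw [Real.norm_ofNat]; linarith
  have hcb : c b + δ < 8 * δ := by
    have h1 : C * (b - t₀) ≤ C * τ := mul_le_mul_of_nonneg_left (by linarith [hb.2]) hC0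
    simp only [c]
    nlinarith
  have h1 := (softMax_le hδ0 (c b) (distFun E (m, b))).trans_lt (max_lt hcb hm1)
  have h2 := (softMax_le hδ0 (c b) (distFun G (m, b))).trans_lt (max_lt hcb hm2)
  have h3 : D - (softMax δ (c b) (distFun E (m, b)) + softMax δ (c b) (distFun G (m, b))) ≤
      φ (m, b) := le_max_right _ _
  rw [hzero b hb m] at h3
  linarith

/-- If the slices are never simultaneously nonempty after `t₀`, there is nothing to prove. Otherwise
one of the slices at `t₀` is bounded, and the roles of `E` and `G` are symmetric. -/
lemma separation_right (hN : 1 ≤ N) (hs0 : 0 < s) (hs1 : s < 1)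
    {E G : Set (Space N × ℝ)} {E0 G0 : Set (Space N)} (hE : IsWeakSuperflow s E E0)
    (hG : IsWeakSuperflow s G G0) {D : ℝ} (hD : 0 < D) {t₀ : ℝ} (ht₀ : 0 ≤ t₀)
    (h : ∀ x ∈ slice E t₀, ∀ y ∈ slice G t₀, D ≤ dist x y) :
    ∃ τ : ℝ, 0 < τ ∧ ∀ r ∈ Ioo t₀ (t₀ + τ), ∀ x ∈ slice E r, ∀ y ∈ slice G r, D ≤ dist x y := by
  by_cases hex : ∃ t₁, t₀ < t₁ ∧ (slice E t₁).Nonempty ∧ (slice G t₁).Nonempty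
  · obtain ⟨t₁, ht₁, hEt₁, hGt₁⟩ := hex
    have hsymm : Bornology.IsBounded (slice G t₀) → ∃ τ : ℝ, 0 < τ ∧ ∀ r ∈ Ioo t₀ (t₀ + τ),
        ∀ x ∈ slice E r, ∀ y ∈ slice G r, D ≤ dist x y := fun hb => by
      obtain ⟨τ, hτ, h1⟩ := separation_right_of_bounded hN hs0 hs1 hG hE hD ht₀ ht₁ hGt₁ hEt₁ hb
        fun x hx y hy => by rw [dist_comm]; exact h y hy x hx
      exact ⟨τ, hτ, fun r hr x hx y hy => by rw [dist_comm]; exact h1 r hr y hy x hx⟩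
    rcases hE.bounded_or_cobounded with hb | hb
    · exact separation_right_of_bounded hN hs0 hs1 hE hG hD ht₀ ht₁ hEt₁ hGt₁ (hb t₀ ht₀) h
    rcases hG.bounded_or_cobounded with hb' | hb'
    · exact hsymm (hb' t₀ ht₀)
    -- Two sets with bounded complements meet, since `ℝ^N` is unbounded for `N ≥ 1`; this
    -- contradicts separation.
    exfalso
    have : Nonempty (Fin N) := ⟨⟨0, hN⟩⟩
    refine NormedSpace.unbounded_univ ℝ (Space N) (((hb t₀ ht₀).union (hb' t₀ ht₀)).subset ?_)
    intro x _
    by_contra hx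
    rw [mem_union, not_or, notMem_compl_iff, notMem_compl_iff] at hx
    have := h x hx.1 x hx.2
    rw [dist_self] at this
    linarith
  · refine ⟨1, one_pos, fun r hr x hx y hy => ?_⟩
    exact absurd ⟨r, hr.1, ⟨x, hx⟩, ⟨y, hy⟩⟩ hex

/-- The distance between two superflows does not drop below a positive initial value. -/
theorem separation_of_superflows (hN : 1 ≤ N) (hs0 : 0 < s) (hs1 : s < 1)
    {E G : Set (Space N × ℝ)} {E0 G0 : Set (Space N)} (hE : IsWeakSuperflow s E E0)
    (hG : IsWeakSuperflow s G G0) {D : ℝ} (hD : 0 < D)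
    (h : ∀ x ∈ slice E 0, ∀ y ∈ slice G 0, D ≤ dist x y) :
    ∀ t : ℝ, 0 ≤ t → ∀ x ∈ slice E t, ∀ y ∈ slice G t, D ≤ dist x y := by
  refine forall_ge_of_local (P := fun t => ∀ x ∈ slice E t, ∀ y ∈ slice G t, D ≤ dist x y) h
    (fun t ht hP => separation_right hN hs0 hs1 hE hG hD ht hP) (fun t ht hP x hx y hy => ?_)
  obtain ⟨r, hr, hlim⟩ := exists_seq_tendsto_left ht
  obtain ⟨u, hu, hux⟩ := (hE.left_continuous t ht r hr hlim).2 x hx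
  obtain ⟨v, hv, hvy⟩ := (hG.left_continuous t ht r hr hlim).2 y hy
  exact ge_of_tendsto' (hux.dist hvy) fun n => hP _ (hr n) _ (hu n) _ (hv n)

end FractionalFlow

end

/-! ### Comparison of a superflow with a subflow -/

theorem mainTheorem10 (N : ℕ) (hN : 1 ≤ N) (s : ℝ) (hs0 : 0 < s) (hs1 : s < 1)
    (E0 F0 : Set (FractionalFlow.Space N))
    (hE0 : IsClosed E0) (hE0' : IsCompact (frontier E0))
    (hF0 : IsClosed F0) (hF0' : IsCompact (frontier F0))
    (E F : Set (FractionalFlow.Space N × ℝ))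
    (hE : FractionalFlow.IsWeakSuperflow s E E0)
    (hF : FractionalFlow.IsWeakSubflow s F F0)
    (hΔ : 0 < FractionalFlow.setDist E0 F0ᶜ) :
    ∀ t : ℝ, 0 ≤ t →
      FractionalFlow.setDist E0 F0ᶜ ≤
        FractionalFlow.setDist (FractionalFlow.slice E t) (FractionalFlow.slice F t)ᶜ := by
  intro t ht
  refine le_iInf₂ fun x hx => le_iInf₂ fun y hy => ?_
  by_contra hlt
  -- The initial distance may be infinite, so the argument runs with a finite `D` strictly between
  -- the offending distance and it.
  obtain ⟨D, hD0, hD1, hD2⟩ := ENNReal.lt_iff_exists_real_btwn.1 (not_le.1 hlt)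
  rw [edist_dist] at hD1
  have hD : dist x y < D := (ENNReal.ofReal_lt_ofReal_iff_of_nonneg dist_nonneg).1 hD1
  -- The complementary superflow starts in the complement of the interior of `F0`, that is, in the
  -- closure of `F0ᶜ`; the lower bound on distances passes to the closure.
  have hinit : ∀ u ∈ E0, ∀ v ∈ closure F0ᶜ, D ≤ dist u v := by
    intro u hu v hv
    have hsub : F0ᶜ ⊆ {v | D ≤ dist u v} := fun w hw => by
      have h1 : ENNReal.ofReal D ≤ edist u w :=
        hD2.le.trans (iInf₂_le_of_le u hu (iInf₂_le w hw))
      rw [edist_dist, ENNReal.ofReal_le_ofReal_iff dist_nonneg] at h1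
      exact h1
    exact closure_minimal hsub (isClosed_le continuous_const (by fun_prop)) hv
  have hsep := FractionalFlow.separation_of_superflows hN hs0 hs1 hE hF.superflow_compl
    (dist_nonneg.trans_lt hD) (fun u hu v hv => hinit u (hE.initial hu) v (by
      rw [closure_compl]; exact hF.superflow_compl.initial hv)) t ht
  exact absurd (hsep x hx y ⟨ht, hy⟩) (not_le.2 hD)
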